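/- Let $\Omega$ be a quadratically closed field of characteristic $2$ (every polynomial of degree $2$ over $\Omega$ has a root in $\Omega$), let $n\ge 0$, and let $B\subset GL(n,\Omega)$ be the group of upper triangular matrices, acting on the quadratic forms over $\Omega$ in the variables $x_1,\dots,x_n$ by $b\cdot x_t=\sum_j b_{t,j}x_j$. For a quadratic form $q$ let $B_q$ be its stabilizer in $B$ and let $\pi$ be the projection of $B$ onto the diagonal matrices. The $B$-rank of the orbit $Bq$ is $n-\dim\pi(B_q)$, where $\dim$ is the dimension of the Zariski closure. A quadratic form is in normal form if it is $q_1+\dots+q_r$, $r\ge 0$, with components $q_t=\epsilon_t x_{i_t}^2+\delta_t x_{i_t}x_{j_t}$ such that: $\epsilon_t,\delta_t\in\{0,1\}$ are not both $0$; the sets $\{i_t,j_t\}$ are pairwise disjoint; $j_t=i_t$ if and only if $\delta_t=0$; $i_1<\dots<i_r$ and $i_t\le j_t$ for all $t$; (C1) if $\epsilon_t=1$ and $\delta_t=0$ then $\epsilon_s=0$ for all $s>t$; (C2) if $s\ne t$ and $i_s<i_t<j_t<j_s$ then $\epsilon_s\epsilon_t=0$. 1. Let $q$ be in normal form and let $Bq$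 have the maximal $B$-rank $n$. Put $r=\lfloor n/2\rfloor$, and $\epsilon=1$ if $n$ is odd, $\epsilon=0$ if $n$ is even. Then $q$ has exactly $r+\epsilon$ components, $q=q_1+\dots+q_r+\epsilon q_{r+1}$, where $q_t=x_{i_t}^2+x_{i_t}x_{j_t}$ with $i_t<j_t$ for $1\le t\le r$, and $q_{r+1}=x_{i_{r+1}}^2$ when $n$ is odd. 2. The number of $B$-orbits of maximal $B$-rank $n$ is the Catalan number $C_m$, where $m=\lfloor (n+1)/2\rfloor$. 3. For a non-nesting perfect matching $M$ of $\{1,\dots,2m\}$ (a perfect matching with no two pairs $a<b$ and $c<d$ such that $a<c<d<b$) put $q_M=\sum_{\{a<b\}\in M}(x_a^2+x_ax_b)$, where $x_{n+1}:=0$ if $n$ is odd. The normal forms $q$ such that $Bq$ has $B$-rank $n$ are exactly the forms $q_M$, and $M\mapsto Bq_M$ is a bijection from the non-nesting perfect matchings of $\{1,\dots,2m\}$ onto the $B$-orbits of $B$-rank $n$. -/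

import Mathlib

/-- A field over which every polynomial of degree `2` has a root, i.e. a field without
quadratic extensions. -/
def IsQuadraticallyClosed (Ω : Type*) [Field Ω] : Prop :=
  ∀ p : Polynomial Ω, p.degree = 2 → ∃ x : Ω, p.IsRoot x

/-- Quadratic forms over `Ω` in `n` variables `x_0, …, x_{n-1}`. -/
abbrev QForm (n : ℕ) (Ω : Type*) [Field Ω] := QuadraticForm Ω (Fin n → Ω)

/-- The quadratic form `x_i x_j` (so `mon i i` is the square `x_i²`). -/
def mon {n : ℕ} {Ω : Type*} [Field Ω] (i j : Fin n) : QForm n Ω :=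
  QuadraticMap.linMulLin (LinearMap.proj i) (LinearMap.proj j)

/-- The substitution action `x_t ↦ ∑ j, g_{t,j} x_j` of `GL(n, Ω)` on quadratic forms,
a right action. -/
def act {n : ℕ} {Ω : Type*} [Field Ω] (g : GL (Fin n) Ω) (q : QForm n Ω) : QForm n Ω :=
  q.comp (Matrix.toLin' (g : Matrix (Fin n) (Fin n) Ω))

theorem act_one {n : ℕ} {Ω : Type*} [Field Ω] (q : QForm n Ω) : act 1 q = q := by
  ext v
  simp [act]

theorem act_mul {n : ℕ} {Ω : Type*} [Field Ω] (g h : GL (Fin n) Ω) (q : QForm n Ω) :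
    act (g * h) q = act h (act g q) := by
  ext v
  simp [act, Matrix.mulVec_mulVec]

/-- The Borel subgroup of upper triangular matrices in `GL(n, Ω)`. -/
def borelSubgroup (n : ℕ) (Ω : Type*) [Field Ω] : Subgroup (GL (Fin n) Ω) where
  carrier := {b | ∀ i j : Fin n, j < i → (b : Matrix (Fin n) (Fin n) Ω) i j = 0}
  one_mem' := by
    intro i j hij
    simp [hij.ne']
  mul_mem' := by
    intro a b ha hb
    exact Matrix.BlockTriangular.mul (b := id) (fun i j h => ha i j h) (fun i j h => hb i j h)
  inv_mem' := by
    intro a ha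
    have hinv : Invertible (a : Matrix (Fin n) (Fin n) Ω) := a.invertible
    have h := Matrix.blockTriangular_inv_of_blockTriangular (b := id)
      (M := (a : Matrix (Fin n) (Fin n) Ω)) (fun i j h => ha i j h)
    intro i j hij
    have h2 := h (i := i) (j := j) hij
    simpa using h2

/-- Two quadratic forms are equivalent when they lie in the same Borel orbit. -/
def borelSetoid (n : ℕ) (Ω : Type*) [Field Ω] : Setoid (QForm n Ω) where
  r p q := ∃ b ∈ borelSubgroup n Ω, act b p = q
  iseqv := by
    refine ⟨fun p => ⟨1, one_mem _, act_one p⟩, ?_, ?_⟩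
    · rintro p q ⟨b, hb, rfl⟩
      refine ⟨b⁻¹, inv_mem hb, ?_⟩
      rw [← act_mul, mul_inv_cancel, act_one]
    · rintro p q s ⟨b, hb, rfl⟩ ⟨c, hc, rfl⟩
      exact ⟨b * c, mul_mem hb hc, act_mul b c p⟩

/-- The set of Borel orbits on the space of quadratic forms in `n` variables. -/
abbrev BorelOrbit (n : ℕ) (Ω : Type*) [Field Ω] := Quotient (borelSetoid n Ω)

/-- The orbit `B q`. -/
def borelOrbit {n : ℕ} {Ω : Type*} [Field Ω] (q : QForm n Ω) : BorelOrbit n Ω :=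
  Quotient.mk (borelSetoid n Ω) q

/-- The image of the stabilizer of `q` in the Borel subgroup under the projection onto the
maximal torus of diagonal matrices; a diagonal matrix is recorded by its diagonal, a vector of
`Ωⁿ`. -/
def toralImage {n : ℕ} {Ω : Type*} [Field Ω] (q : QForm n Ω) : Set (Fin n → Ω) :=
  {d | ∃ b ∈ borelSubgroup n Ω, act b q = q ∧ d = fun k => (b : Matrix (Fin n) (Fin n) Ω) k k}

/-- The dimension of a subset of affine `n`-space: the Krull dimension of the coordinate ring of
its Zariski closure. (It is `0` for the empty set.) -/
noncomputable def zariskiDim {n : ℕ} {Ω : Type*} [Field Ω] (S : Set (Fin n → Ω)) : ℕ :=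
  ((ringKrullDim (MvPolynomial (Fin n) Ω ⧸ MvPolynomial.vanishingIdeal Ω S)).unbotD 0).toNat

theorem ringKrullDim_coordinateRing_le {n : ℕ} {Ω : Type*} [Field Ω] (S : Set (Fin n → Ω)) :
    ringKrullDim (MvPolynomial (Fin n) Ω ⧸ MvPolynomial.vanishingIdeal Ω S) ≤ n := by
  refine (ringKrullDim_quotient_le _).trans ?_
  rw [MvPolynomial.ringKrullDim_of_isNoetherianRing]
  simp

/-- No truncation occurs in `zariskiDim` on non-empty sets. -/
theorem coe_zariskiDim {n : ℕ} {Ω : Type*} [Field Ω] (S : Set (Fin n → Ω)) (hS : S.Nonempty) :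
    ((zariskiDim S : ℕ) : WithBot ℕ∞) =
      ringKrullDim (MvPolynomial (Fin n) Ω ⧸ MvPolynomial.vanishingIdeal Ω S) := by
  have hle := ringKrullDim_coordinateRing_le S
  have hnt : Nontrivial (MvPolynomial (Fin n) Ω ⧸ MvPolynomial.vanishingIdeal Ω S) := by
    rw [Ideal.Quotient.nontrivial_iff, Ideal.ne_top_iff_one]
    obtain ⟨x, hx⟩ := hS
    intro h
    simpa using h x hx
  have hge := ringKrullDim_nonneg_of_nontrivial
    (R := MvPolynomial (Fin n) Ω ⧸ MvPolynomial.vanishingIdeal Ω S)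
  unfold zariskiDim
  generalize ringKrullDim (MvPolynomial (Fin n) Ω ⧸ MvPolynomial.vanishingIdeal Ω S) = d at *
  induction d using WithBot.recBotCoe with
  | bot => simp at hge
  | coe d =>
    have hd : d ≤ (n : ℕ∞) := by exact_mod_cast hle
    have hd' : d ≠ ⊤ := ne_top_of_le_ne_top (ENat.natCast_ne_top n) hd
    rw [WithBot.unbotD_coe]
    exact congrArg WithBot.some (ENat.natCast_toNat hd')

theorem zariskiDim_le {n : ℕ} {Ω : Type*} [Field Ω] (S : Set (Fin n → Ω)) (hS : S.Nonempty) :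
    zariskiDim S ≤ n := by
  have h := ringKrullDim_coordinateRing_le S
  rw [← coe_zariskiDim S hS] at h
  exact_mod_cast h

/-- `n - dim π(B_q)`; the subtraction is not truncated, by `zariskiDim_le`. -/
noncomputable def formBRank {n : ℕ} {Ω : Type*} [Field Ω] (q : QForm n Ω) : ℕ :=
  n - zariskiDim (toralImage q)

theorem toralImage_nonempty {n : ℕ} {Ω : Type*} [Field Ω] (q : QForm n Ω) :
    (toralImage q).Nonempty := ⟨_, 1, one_mem _, act_one q, rfl⟩

theorem borel_mul_diag {n : ℕ} {Ω : Type*} [Field Ω] {a b : GL (Fin n) Ω}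
    (ha : a ∈ borelSubgroup n Ω) (hb : b ∈ borelSubgroup n Ω) (k : Fin n) :
    ((a * b : GL (Fin n) Ω) : Matrix (Fin n) (Fin n) Ω) k k =
      (a : Matrix (Fin n) (Fin n) Ω) k k * (b : Matrix (Fin n) (Fin n) Ω) k k := by
  rw [Units.val_mul, Matrix.mul_apply]
  refine Finset.sum_eq_single k ?_ (by simp)
  intro j _ hj
  rcases lt_or_gt_of_ne hj with h | h
  · rw [ha k j h, zero_mul]
  · rw [hb j k h, mul_zero]

theorem toralImage_subset_act {n : ℕ} {Ω : Type*} [Field Ω] {c : GL (Fin n) Ω}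
    (hc : c ∈ borelSubgroup n Ω) (q : QForm n Ω) : toralImage q ⊆ toralImage (act c q) := by
  rintro d ⟨b, hb, hbq, rfl⟩
  refine ⟨c⁻¹ * b * c, mul_mem (mul_mem (inv_mem hc) hb) hc, ?_, ?_⟩
  · rw [← act_mul, ← mul_assoc, ← mul_assoc, mul_inv_cancel, one_mul, act_mul, hbq]
  · funext k
    rw [borel_mul_diag (mul_mem (inv_mem hc) hb) hc, borel_mul_diag (inv_mem hc) hb,
      mul_right_comm, ← borel_mul_diag (inv_mem hc) hc, inv_mul_cancel]
    simp

theorem toralImage_act {n : ℕ} {Ω : Type*} [Field Ω] {c : GL (Fin n) Ω}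
    (hc : c ∈ borelSubgroup n Ω) (q : QForm n Ω) : toralImage (act c q) = toralImage q := by
  refine Set.Subset.antisymm ?_ (toralImage_subset_act hc q)
  have h := toralImage_subset_act (inv_mem hc) (act c q)
  rwa [← act_mul, mul_inv_cancel, act_one] at h

/-- The `B`-rank of a Borel orbit `B q`, namely `n - dim π(B_q)`. -/
noncomputable def bRank {n : ℕ} {Ω : Type*} [Field Ω] : BorelOrbit n Ω → ℕ :=
  Quotient.lift formBRank (by
    rintro p q ⟨b, hb, rfl⟩
    unfold formBRank
    rw [toralImage_act hb])

/-- The data of a quadratic form `q_1 + ⋯ + q_r` in normal form, with components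
`q_t = ε_t x_{i_t}² + δ_t x_{i_t} x_{j_t}`. Components are numbered from `0` to `r - 1`. -/
structure NormalData (n : ℕ) where
  r : ℕ
  i : Fin r → Fin n
  j : Fin r → Fin n
  ε : Fin r → Bool
  δ : Fin r → Bool
  ne_zero : ∀ t, ε t = true ∨ δ t = true
  disjoint : ∀ s t, s ≠ t → Disjoint ({i s, j s} : Set (Fin n)) {i t, j t}
  j_eq_iff : ∀ t, j t = i t ↔ δ t = false
  i_strictMono : StrictMono i
  i_le_j : ∀ t, i t ≤ j t
  c1 : ∀ t, ε t = true → δ t = false → ∀ s, t < s → ε s = false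
  c2 : ∀ s t, s ≠ t → i s < i t → i t < j t → j t < j s → ¬ (ε s = true ∧ ε t = true)

/-- The normal component `q_t = ε_t x_{i_t}² + δ_t x_{i_t} x_{j_t}`. -/
def NormalData.component {n : ℕ} (D : NormalData n) (Ω : Type*) [Field Ω] (t : Fin D.r) :
    QForm n Ω :=
  (if D.ε t = true then mon (D.i t) (D.i t) else 0) +
    (if D.δ t = true then mon (D.i t) (D.j t) else 0)

/-- The quadratic form `q_1 + ⋯ + q_r`. -/
def NormalData.form {n : ℕ} (D : NormalData n) (Ω : Type*) [Field Ω] : QForm n Ω :=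
  ∑ t, D.component Ω t

/-- `q` is in normal form. -/
def IsNormalForm {n : ℕ} {Ω : Type*} [Field Ω] (q : QForm n Ω) : Prop :=
  ∃ D : NormalData n, D.form Ω = q

/-- A perfect matching of `{0, …, N-1}`, given as the set of its pairs `(a, b)` with `a < b`, in
which no pair is nested in another one. -/
structure IsNonNestingMatching {N : ℕ} (M : Finset (Fin N × Fin N)) : Prop where
  lt : ∀ p ∈ M, p.1 < p.2
  perfect : ∀ v : Fin N, ∃! p, p ∈ M ∧ (v = p.1 ∨ v = p.2)
  not_nested : ∀ p ∈ M, ∀ p' ∈ M, ¬ (p.1 < p'.1 ∧ p'.2 < p.2)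

/-- The variable `x_k` as a linear form on `Ωⁿ`, with `x_k = 0` for `k ≥ n`. -/
def coordForm (n : ℕ) (Ω : Type*) [Field Ω] (k : ℕ) : (Fin n → Ω) →ₗ[Ω] Ω :=
  if h : k < n then LinearMap.proj ⟨k, h⟩ else 0

/-- The quadratic form `∑ (x_a² + x_a x_b)` over the pairs `(a, b)` of `M`, in the variables
`x_0, …, x_{n-1}`; a pair `(a, b)` with `a < n ≤ b` contributes `x_a²`. -/
def matchingForm (n : ℕ) (Ω : Type*) [Field Ω] {N : ℕ} (M : Finset (Fin N × Fin N)) : QForm n Ω :=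
  ∑ p ∈ M, (QuadraticMap.linMulLin (coordForm n Ω p.1) (coordForm n Ω p.1) +
    QuadraticMap.linMulLin (coordForm n Ω p.1) (coordForm n Ω p.2))

/-!
A quadratic form is determined by its values and its polar form on the standard basis, and two
forms lie in the same Borel orbit exactly if one arises from the other by evaluating on a triangular
family of vectors. Symplectic elimination along the flag (`exists_act_polar_of_partial`) therefore
brings every form to the shape `∑ ε_i x_i² + ∑ x_i x_{σ i}` for an involution `σ` (`HasShape`).
This involution is an invariant of the orbit, by the uniqueness argument of the Bruhat
decomposition: an element of the Borel subgroup carrying the shape of `σ` to that of `τ` forces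
`τ (σ k) ≤ k` for all `k`, hence `τ = σ` (`HasShape.unique`).

The `B`-rank is `n` exactly if the toral image is zero-dimensional, and then it is finite, because
its coordinate ring is Artinian (`finite_of_zariskiDim_eq_zero`). An orbit of `σ` that carries no
square contributes a one-dimensional torus (`HasShape.toralImage_infinite`). So in a form of maximal
`B`-rank every orbit of `σ` carries a square, and no admissible substitution may remove one. Such a
substitution exists whenever two pairs are nested, or something lies behind a fixed point without
being the larger point of a pair; hence `σ` is non-nesting (`HasShape.isNonNestingInvolution`).
Conversely, if `σ` is non-nesting then a stabilizing matrix is diagonal in the columns `i ≤ σ i`, by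
the entrywise comparison used for uniqueness, and the squares make the diagonal entries equal to
`1`: the toral image is trivial (`IsNonNestingInvolution.toralImage_eq`).

Pairing the fixed point, if there is one, with an additional last point turns non-nesting
involutions into non-nesting perfect matchings. Such a matching pairs the `k`-th opener with the
`k`-th closer, so it is determined by the Dyck word of its openers, and the count is a Catalan
number (`ncard_isNonNestingMatching`).
-/

/-! ### Forms on the standard basis, triangular substitutions and zero-dimensional sets -/

/-- Quadratic forms in `n` variables agree when they and their polar forms agree on the standard
basis. -/
theorem QForm.ext_basis {n : ℕ} {Ω : Type*} [Field Ω] {p q : QForm n Ω}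
    (h : ∀ i, p (Pi.single i 1) = q (Pi.single i 1))
    (hp : ∀ i j, i ≠ j → QuadraticMap.polar p (Pi.single i 1) (Pi.single j 1) =
      QuadraticMap.polar q (Pi.single i 1) (Pi.single j 1)) : p = q := by
  ext v
  rw [← p.sum_repr_sq_add_sum_repr_mul_polar (Pi.basisFun Ω (Fin n)) v,
    ← q.sum_repr_sq_add_sum_repr_mul_polar (Pi.basisFun Ω (Fin n)) v]
  congr 1
  · congr 1
    congr 1
    ext i
    simpa using h i
  · refine Finset.sum_congr rfl fun s hs => ?_
    congr 1
    induction s with | h i j =>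
    have hij : i ≠ j := by simpa using (Finset.mem_filter.mp hs).2
    simpa [QuadraticMap.polarSym2] using hp i j hij

/-- Vectors `v k` in the span of the first `k + 1` standard basis vectors, but not of the first
`k`. -/
structure IsTriangular {n : ℕ} {Ω : Type*} [Field Ω] (v : Fin n → Fin n → Ω) : Prop where
  apply_of_lt : ∀ k i, k < i → v k i = 0
  apply_self_ne_zero : ∀ k, v k k ≠ 0

/-- A triangular family consists of the columns of an upper triangular matrix. -/
theorem IsTriangular.exists_borel {n : ℕ} {Ω : Type*} [Field Ω] {v : Fin n → Fin n → Ω}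
    (hv : IsTriangular v) : ∃ b ∈ borelSubgroup n Ω,
      ∀ k, (b : Matrix (Fin n) (Fin n) Ω).col k = v k := by
  have hdet : IsUnit (Matrix.of fun i k => v k i).det := by
    rw [Matrix.det_of_isUpperTriangular (M := Matrix.of fun i k => v k i)
      fun i k h => hv.apply_of_lt k i h]
    exact isUnit_iff_ne_zero.mpr (Finset.prod_ne_zero_iff.mpr fun k _ => hv.apply_self_ne_zero k)
  exact ⟨Matrix.nonsingInvUnit _ hdet, fun i k h => hv.apply_of_lt k i h, fun k => rfl⟩

theorem act_apply {n : ℕ} {Ω : Type*} [Field Ω] (b : GL (Fin n) Ω) (q : QForm n Ω)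
    (v : Fin n → Ω) : act b q v = q ((b : Matrix (Fin n) (Fin n) Ω).mulVec v) := rfl

theorem act_apply_single {n : ℕ} {Ω : Type*} [Field Ω] (b : GL (Fin n) Ω) (q : QForm n Ω)
    (k : Fin n) : act b q (Pi.single k 1) = q ((b : Matrix (Fin n) (Fin n) Ω).col k) := by
  rw [act_apply, Matrix.mulVec_single_one]

theorem polar_act {n : ℕ} {Ω : Type*} [Field Ω] (b : GL (Fin n) Ω) (q : QForm n Ω)
    (v w : Fin n → Ω) : QuadraticMap.polar (act b q) v w =
      QuadraticMap.polar q ((b : Matrix (Fin n) (Fin n) Ω).mulVec v)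
        ((b : Matrix (Fin n) (Fin n) Ω).mulVec w) := by
  simp [QuadraticMap.polar, act_apply, Matrix.mulVec_add]

theorem polar_act_single {n : ℕ} {Ω : Type*} [Field Ω] (b : GL (Fin n) Ω) (q : QForm n Ω)
    (i j : Fin n) : QuadraticMap.polar (act b q) (Pi.single i 1) (Pi.single j 1) =
      QuadraticMap.polar q ((b : Matrix (Fin n) (Fin n) Ω).col i)
        ((b : Matrix (Fin n) (Fin n) Ω).col j) := by
  rw [polar_act, Matrix.mulVec_single_one, Matrix.mulVec_single_one]

/-- A diagonal matrix that fixes `q` contributes its diagonal to the toral image. -/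
theorem mem_toralImage_of_diagonal {n : ℕ} {Ω : Type*} [Field Ω] {q : QForm n Ω} {d : Fin n → Ω}
    (hd : ∀ i, d i ≠ 0)
    (hq : ∀ i, d i * d i * q (Pi.single i 1) = q (Pi.single i 1))
    (hp : ∀ i j, i ≠ j → d i * d j * QuadraticMap.polar q (Pi.single i 1) (Pi.single j 1) =
      QuadraticMap.polar q (Pi.single i 1) (Pi.single j 1)) : d ∈ toralImage q := by
  have hv : IsTriangular fun k => d k • (Pi.single k 1 : Fin n → Ω) :=
    ⟨fun k i h => by simp [h.ne'], fun k => by simpa using hd k⟩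
  obtain ⟨b, hb, hbv⟩ := hv.exists_borel
  refine ⟨b, hb, QForm.ext_basis (fun i => ?_) (fun i j hij => ?_), funext fun k => ?_⟩
  · rw [act_apply_single, hbv, QuadraticMap.map_smul, smul_eq_mul, hq]
  · rw [polar_act_single, hbv, hbv, QuadraticMap.polar_smul_left, QuadraticMap.polar_smul_right,
      smul_smul, smul_eq_mul, hp i j hij]
  · have h := congrFun (hbv k) k
    simpa [Matrix.col] using h.symm

section QuadraticallyClosed

variable {Ω : Type*} [Field Ω]

theorem IsQuadraticallyClosed.exists_root (hΩ : IsQuadraticallyClosed Ω) {a b c : Ω}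
    (ha : a ≠ 0) : ∃ x, a * x ^ 2 + b * x + c = 0 := by
  obtain ⟨x, hx⟩ := hΩ _ (Polynomial.degree_quadratic ha (b := b) (c := c))
  exact ⟨x, by simpa using hx⟩

theorem IsQuadraticallyClosed.exists_mul_self (hΩ : IsQuadraticallyClosed Ω) (a : Ω) :
    ∃ x, x * x = a := by
  obtain ⟨x, hx⟩ := hΩ.exists_root (one_ne_zero (α := Ω)) (b := 0) (c := -a)
  exact ⟨x, by linear_combination hx⟩

/-- Over a finite field the map `x ↦ x² - x` is not injective, hence misses a value. -/
theorem IsQuadraticallyClosed.infinite (hΩ : IsQuadraticallyClosed Ω) : Infinite Ω := by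
  by_contra hfin
  rw [not_infinite_iff_finite] at hfin
  have hsurj : Function.Surjective fun x : Ω => x ^ 2 - x := fun a => by
    obtain ⟨x, hx⟩ := hΩ.exists_root (one_ne_zero (α := Ω)) (b := -1) (c := -a)
    exact ⟨x, by simp only; linear_combination hx⟩
  exact zero_ne_one
    (Finite.injective_iff_surjective.mpr hsurj (by simp : (0 : Ω) ^ 2 - 0 = 1 ^ 2 - 1))

end QuadraticallyClosed

/-- A set of points whose Zariski closure has dimension zero is finite: the coordinate ring is
Artinian, and the points give distinct maximal ideals of it. -/
theorem finite_of_zariskiDim_eq_zero {n : ℕ} {Ω : Type*} [Field Ω] {S : Set (Fin n → Ω)}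
    (hS : zariskiDim S = 0) : S.Finite := by
  rcases S.eq_empty_or_nonempty with rfl | hne
  · exact Set.finite_empty
  set I := MvPolynomial.vanishingIdeal Ω S
  have hdim : Ring.KrullDimLE 0 (MvPolynomial (Fin n) Ω ⧸ I) := by
    rw [Ring.krullDimLE_iff, ← coe_zariskiDim S hne, hS]
  have hart : IsArtinianRing (MvPolynomial (Fin n) Ω ⧸ I) :=
    isArtinianRing_iff_krullDimLE_zero.mpr hdim
  have hker : ∀ x : S, ∀ p ∈ I, MvPolynomial.aeval (x : Fin n → Ω) p = 0 := fun x p hp => hp x x.2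
  let f : S → (MvPolynomial (Fin n) Ω ⧸ I) →ₐ[Ω] Ω := fun x =>
    Ideal.Quotient.liftₐ I (MvPolynomial.aeval (x : Fin n → Ω)) (hker x)
  let g : S → PrimeSpectrum (MvPolynomial (Fin n) Ω ⧸ I) := fun x =>
    ⟨RingHom.ker (f x), RingHom.ker_isPrime _⟩
  refine Finite.of_injective g fun x y hxy => Subtype.ext (funext fun k => ?_)
  have hmem : Ideal.Quotient.mk I (MvPolynomial.X k - MvPolynomial.C ((x : Fin n → Ω) k)) ∈
      RingHom.ker (f x) := by
    simp [f, RingHom.mem_ker, Ideal.Quotient.liftₐ_apply]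
  rw [show RingHom.ker (f x) = RingHom.ker (f y) from congrArg PrimeSpectrum.asIdeal hxy] at hmem
  have h : (y : Fin n → Ω) k - (x : Fin n → Ω) k = 0 := by
    simpa [f, RingHom.mem_ker, Ideal.Quotient.liftₐ_apply] using hmem
  exact (sub_eq_zero.mp h).symm

theorem zariskiDim_singleton {n : ℕ} {Ω : Type*} [Field Ω] (x : Fin n → Ω) :
    zariskiDim {x} = 0 := by
  have h := coe_zariskiDim {x} (Set.singleton_nonempty x)
  rw [ringKrullDim_eq_zero_of_isField
    ((Ideal.Quotient.maximal_ideal_iff_isField_quotient _).mp inferInstance)] at h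
  exact_mod_cast h

/-- For `n = 0` both sides hold. -/
theorem bRank_borelOrbit_eq_iff {n : ℕ} {Ω : Type*} [Field Ω] (q : QForm n Ω) :
    bRank (borelOrbit q) = n ↔ zariskiDim (toralImage q) = 0 := by
  have h := zariskiDim_le _ (toralImage_nonempty q)
  change n - zariskiDim (toralImage q) = n ↔ _
  omega

theorem toralImage_finite_of_bRank_eq {n : ℕ} {Ω : Type*} [Field Ω] {q : QForm n Ω}
    (h : bRank (borelOrbit q) = n) : (toralImage q).Finite :=
  finite_of_zariskiDim_eq_zero ((bRank_borelOrbit_eq_iff q).mp h)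

/-! ### Reduction of a form to an involution -/

/-- The form `∑ ε_i x_i² + ∑ x_i x_{σ i}`, the second sum over the two-element orbits of the
involution `σ`, described by its values and its polar form on the standard basis. -/
structure HasShape {n : ℕ} {Ω : Type*} [Field Ω] (q : QForm n Ω) (σ : Fin n → Fin n)
    (ε : Fin n → Ω) : Prop where
  involutive : Function.Involutive σ
  apply_single : ∀ i, q (Pi.single i 1) = ε i
  polar_single : ∀ i j, QuadraticMap.polar q (Pi.single i 1) (Pi.single j 1) =
    if i ≠ j ∧ σ i = j then 1 else 0

theorem IsTriangular.exists_act {n : ℕ} {Ω : Type*} [Field Ω] {v : Fin n → Fin n → Ω}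
    (hv : IsTriangular v) (q : QForm n Ω) : ∃ b ∈ borelSubgroup n Ω,
      (∀ i, act b q (Pi.single i 1) = q (v i)) ∧
      ∀ i j, QuadraticMap.polar (act b q) (Pi.single i 1) (Pi.single j 1) =
        QuadraticMap.polar q (v i) (v j) := by
  obtain ⟨b, hb, hbv⟩ := hv.exists_borel
  refine ⟨b, hb, fun i => ?_, fun i j => ?_⟩
  · rw [act_apply_single, hbv]
  · rw [polar_act_single, hbv, hbv]

theorem polar_self_eq_zero {n : ℕ} {Ω : Type*} [Field Ω] [CharP Ω 2] (q : QForm n Ω)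
    (v : Fin n → Ω) : QuadraticMap.polar q v v = 0 := by
  rw [QuadraticMap.polar_self, two_nsmul, CharTwo.add_self_eq_zero]

/-- Symplectic elimination, by induction on the complement of `S`: the basis vectors indexed by `S`
are already paired by `σ` and orthogonal to everything else. The smallest `i ∉ S` is either in the
radical, or gets paired with the smallest `j` to which it is not orthogonal. -/
theorem exists_act_polar_of_partial {n : ℕ} {Ω : Type*} [Field Ω] [CharP Ω 2] (m : ℕ) :
    ∀ (S : Finset (Fin n)) (q : QForm n Ω) (σ : Fin n → Fin n), Sᶜ.card = m →
      Function.Involutive σ → (∀ i ∈ S, σ i ∈ S) → (∀ i ∉ S, σ i = i) →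
      (∀ i ∈ S, ∀ k, QuadraticMap.polar q (Pi.single i 1) (Pi.single k 1) =
        if i ≠ k ∧ σ i = k then 1 else 0) →
      ∃ b ∈ borelSubgroup n Ω, ∃ τ : Fin n → Fin n, Function.Involutive τ ∧
        ∀ i k, QuadraticMap.polar (act b q) (Pi.single i 1) (Pi.single k 1) =
          if i ≠ k ∧ τ i = k then 1 else 0 := by
  induction m using Nat.strong_induction_on with | _ m ih
  intro S q σ hm hσ hS hσS hq
  rcases Sᶜ.eq_empty_or_nonempty with hemp | hne
  · rw [Finset.compl_eq_empty_iff] at hemp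
    refine ⟨1, one_mem _, σ, hσ, fun i k => ?_⟩
    rw [act_one]
    exact hq i (hemp ▸ Finset.mem_univ i) k
  obtain ⟨i, hi, hmin⟩ : ∃ i ∉ S, ∀ k ∉ S, i ≤ k :=
    ⟨Sᶜ.min' hne, Finset.mem_compl.mp (Finset.min'_mem _ hne),
      fun k hk => Finset.min'_le _ _ (Finset.mem_compl.mpr hk)⟩
  by_cases h0 : ∀ k, QuadraticMap.polar q (Pi.single i 1) (Pi.single k 1) = 0
  · refine ih (insert i S)ᶜ.card ?_ (insert i S) q σ rfl hσ ?_ ?_ ?_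
    · rw [← hm]
      exact Finset.card_lt_card (Finset.compl_ssubset_compl.mpr (Finset.ssubset_insert hi))
    · intro k hk
      rcases Finset.mem_insert.mp hk with rfl | hk
      · rw [hσS k hi]; exact Finset.mem_insert_self _ _
      · exact Finset.mem_insert_of_mem (hS k hk)
    · intro k hk
      exact hσS k fun h => hk (Finset.mem_insert_of_mem h)
    · intro k hk l
      rcases Finset.mem_insert.mp hk with rfl | hk
      · rw [h0, if_neg]
        rintro ⟨h1, h2⟩
        exact h1 ((hσS k hi).symm.trans h2)
      · exact hq k hk l
  · push Not at h0
    obtain ⟨j, hj, hjmin⟩ : ∃ j, QuadraticMap.polar q (Pi.single i 1) (Pi.single j 1) ≠ 0 ∧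
        ∀ k, QuadraticMap.polar q (Pi.single i 1) (Pi.single k 1) ≠ 0 → j ≤ k := by
      obtain ⟨j, hj, h⟩ := WellFounded.has_min (wellFounded_lt (α := Fin n))
        {k | QuadraticMap.polar q (Pi.single i 1) (Pi.single k 1) ≠ 0} h0
      exact ⟨j, hj, fun k hk => not_lt.mp (h k hk)⟩
    have hsym : ∀ k l, QuadraticMap.polar q (Pi.single k 1) (Pi.single l 1) =
        QuadraticMap.polar q (Pi.single l 1) (Pi.single k 1) := fun k l =>
      QuadraticMap.polar_comm _ _ _
    have hSout : ∀ k ∈ S, ∀ l ∉ S, QuadraticMap.polar q (Pi.single k 1) (Pi.single l 1) = 0 := by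
      intro k hk l hl
      rw [hq k hk, if_neg]
      rintro ⟨-, rfl⟩
      exact hl (hS k hk)
    have hjS : j ∉ S := fun h => hj (by rw [hsym, hSout j h i hi])
    have hij : i < j := lt_of_le_of_ne (hmin j hjS) fun h => hj (by rw [h, polar_self_eq_zero])
    set c := QuadraticMap.polar q (Pi.single i 1) (Pi.single j 1) with hc
    -- `e_j` is scaled, and the other `e_k` are made orthogonal to `e_i` and `e_j`. The multiple of
    -- `e_j` used here vanishes for `k < j` by minimality of `j`, so the family is triangular.
    let v : Fin n → Fin n → Ω := fun k =>
      if k ∈ S ∨ k = i then Pi.single k 1 else if k = j then c⁻¹ • Pi.single j 1 else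
        Pi.single k 1 - (QuadraticMap.polar q (Pi.single i 1) (Pi.single k 1) / c) • Pi.single j 1 -
          (QuadraticMap.polar q (Pi.single j 1) (Pi.single k 1) / c) • Pi.single i 1
    have hvS : ∀ k ∈ S, v k = Pi.single k 1 := fun k hk => by simp [v, hk]
    have hvi : v i = Pi.single i 1 := by simp [v]
    have hvj : v j = c⁻¹ • Pi.single j 1 := by simp [v, hjS, hij.ne']
    have hvk : ∀ k ∉ S, k ≠ i → k ≠ j → v k = Pi.single k 1 -
        (QuadraticMap.polar q (Pi.single i 1) (Pi.single k 1) / c) • Pi.single j 1 -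
          (QuadraticMap.polar q (Pi.single j 1) (Pi.single k 1) / c) • Pi.single i 1 :=
      fun k h1 h2 h3 => by simp [v, h1, h2, h3]
    have hik : ∀ k ∉ S, k ≠ i → i < k := fun k h1 h2 => lt_of_le_of_ne (hmin k h1) h2.symm
    have hβ : ∀ k ∉ S, k ≠ j → k ≤ j →
        QuadraticMap.polar q (Pi.single i 1) (Pi.single k 1) = 0 := by
      intro k _ h2 h3
      by_contra h
      exact h2 (le_antisymm h3 (hjmin k h))
    have hv : IsTriangular v := by
      constructor
      · intro k l hkl
        by_cases h1 : k ∈ S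
        · simp [hvS k h1, hkl.ne']
        by_cases h2 : k = i
        · subst h2; simp [hvi, hkl.ne']
        by_cases h3 : k = j
        · subst h3; simp [hvj, hkl.ne']
        rw [hvk k h1 h2 h3]
        have hil := ((hik k h1 h2).trans hkl).ne'
        rcases le_or_gt k j with h4 | h4
        · simp [hkl.ne', hil, hβ k h1 h3 h4]
        · simp [hkl.ne', hil, (h4.trans hkl).ne']
      · intro k
        by_cases h1 : k ∈ S
        · simp [hvS k h1]
        by_cases h2 : k = i
        · subst h2; simp [hvi]
        by_cases h3 : k = j
        · subst h3; simpa [hvj] using hj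
        rw [hvk k h1 h2 h3]
        simp [h2, h3]
    obtain ⟨b, hb, -, hbp⟩ := hv.exists_act q
    let σ' : Fin n → Fin n := fun k => if k = i then j else if k = j then i else σ k
    have hσi : σ' i = j := by simp [σ']
    have hσj : σ' j = i := by simp [σ', hij.ne']
    have hσk : ∀ k, k ≠ i → k ≠ j → σ' k = σ k := fun k h1 h2 => by simp [σ', h1, h2]
    have hσne : ∀ k, k ≠ i → k ≠ j → σ k ≠ i ∧ σ k ≠ j := by
      intro k h1 h2
      refine ⟨fun h => h1 ?_, fun h => h2 ?_⟩
      · rw [← hσ k, h, hσS i hi]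
      · rw [← hσ k, h, hσS j hjS]
    have hiv : ∀ k, QuadraticMap.polar q (Pi.single i 1) (v k) = if j = k then 1 else 0 := by
      intro k
      by_cases h1 : k ∈ S
      · rw [hvS k h1, hsym, hSout k h1 i hi, if_neg]
        rintro rfl; exact hjS h1
      by_cases h2 : k = i
      · subst h2; rw [hvi, polar_self_eq_zero, if_neg hij.ne']
      by_cases h3 : k = j
      · subst h3; rw [hvj, QuadraticMap.polar_smul_right, ← hc, smul_eq_mul, inv_mul_cancel₀ hj,
          if_pos rfl]
      · rw [hvk k h1 h2 h3, QuadraticMap.polar_sub_right, QuadraticMap.polar_sub_right,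
          QuadraticMap.polar_smul_right, QuadraticMap.polar_smul_right, ← hc, polar_self_eq_zero,
          if_neg (Ne.symm h3), smul_zero, smul_eq_mul, div_mul_cancel₀ _ hj, sub_self, sub_zero]
    have hjv : ∀ k, QuadraticMap.polar q (v j) (v k) = if i = k then 1 else 0 := by
      intro k
      rw [hvj, QuadraticMap.polar_smul_left]
      by_cases h1 : k ∈ S
      · rw [hvS k h1, hsym, hSout k h1 j hjS, if_neg, smul_zero]
        rintro rfl; exact hi h1
      by_cases h2 : k = i
      · subst h2; rw [hvi, hsym, ← hc, smul_eq_mul, inv_mul_cancel₀ hj, if_pos rfl]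
      by_cases h3 : k = j
      · subst h3; rw [hvj, QuadraticMap.polar_smul_right, polar_self_eq_zero, smul_zero, smul_zero,
          if_neg hij.ne]
      · rw [hvk k h1 h2 h3, QuadraticMap.polar_sub_right, QuadraticMap.polar_sub_right,
          QuadraticMap.polar_smul_right, QuadraticMap.polar_smul_right, hsym j i, ← hc,
          polar_self_eq_zero, if_neg (Ne.symm h2), smul_zero, smul_eq_mul,
          smul_eq_mul, div_mul_cancel₀ _ hj, sub_zero, sub_self, mul_zero]
    have hSv : ∀ s ∈ S, ∀ k, QuadraticMap.polar q (Pi.single s 1) (v k) =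
        if s ≠ k ∧ σ s = k then 1 else 0 := by
      intro s hs k
      rw [← hq s hs k]
      by_cases h1 : k ∈ S
      · rw [hvS k h1]
      by_cases h2 : k = i
      · subst h2; rw [hvi]
      by_cases h3 : k = j
      · subst h3; rw [hvj, QuadraticMap.polar_smul_right, hSout s hs k hjS, smul_zero]
      · rw [hvk k h1 h2 h3, QuadraticMap.polar_sub_right, QuadraticMap.polar_sub_right,
          QuadraticMap.polar_smul_right, QuadraticMap.polar_smul_right, hSout s hs i hi,
          hSout s hs j hjS, smul_zero, smul_zero, sub_zero, sub_zero]
    have hsub : S ⊂ insert i (insert j S) :=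
      (Finset.ssubset_insert hjS).trans (Finset.ssubset_insert (by simp [hij.ne, hi]))
    obtain ⟨b', hb', τ, hτ, hτq⟩ := ih (insert i (insert j S))ᶜ.card
      (hm ▸ Finset.card_lt_card (Finset.compl_ssubset_compl.mpr hsub))
      (insert i (insert j S)) (act b q) σ' rfl (by
        intro k
        by_cases h1 : k = i
        · subst h1; rw [hσi, hσj]
        by_cases h2 : k = j
        · subst h2; rw [hσj, hσi]
        rw [hσk k h1 h2, hσk _ (hσne k h1 h2).1 (hσne k h1 h2).2, hσ]) (by
        intro k hk
        by_cases h1 : k = i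
        · subst h1; simp [hσi]
        by_cases h2 : k = j
        · subst h2; simp [hσj]
        rw [hσk k h1 h2]
        simp only [Finset.mem_insert, h1, h2, false_or] at hk
        simp [hS k hk]) (by
        intro k hk
        simp only [Finset.mem_insert, not_or] at hk
        rw [hσk k hk.1 hk.2.1, hσS k hk.2.2]) (by
        intro s hs k
        rw [hbp]
        by_cases h1 : s = i
        · subst h1
          rw [hvi, hiv, hσi]
          exact if_congr ⟨fun h => ⟨h ▸ hij.ne, h⟩, fun h => h.2⟩ rfl rfl
        by_cases h2 : s = j
        · subst h2
          rw [hjv, hσj]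
          exact if_congr ⟨fun h => ⟨h ▸ hij.ne', h⟩, fun h => h.2⟩ rfl rfl
        simp only [Finset.mem_insert, h1, h2, false_or] at hs
        rw [hvS s hs, hSv s hs, hσk s h1 h2])
    exact ⟨b * b', mul_mem hb hb', τ, hτ, by rwa [act_mul]⟩

theorem exists_hasShape {n : ℕ} {Ω : Type*} [Field Ω] [CharP Ω 2] (q : QForm n Ω) :
    ∃ b ∈ borelSubgroup n Ω, ∃ σ ε, HasShape (act b q) σ ε := by
  obtain ⟨b, hb, σ, hσ, h⟩ := exists_act_polar_of_partial _ ∅ q id rfl (fun _ => rfl) (by simp)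
    (by simp) (by simp)
  exact ⟨b, hb, σ, _, hσ, fun _ => rfl, h⟩

/-! ### Forms with finite toral image -/

/-- The combinatorial type of a form of maximal `B`-rank: an involution whose two-element orbits
are not nested, and such that every point behind a fixed point is the larger one of its orbit. The
second condition says that nothing is nested either if a fixed point is paired with a point at
infinity. -/
structure IsNonNestingInvolution {n : ℕ} (σ : Fin n → Fin n) : Prop where
  involutive : Function.Involutive σ
  not_nested : ∀ a b, a < b → b < σ b → ¬ σ b < σ a
  lt_of_fixed : ∀ f k, σ f = f → f < k → σ k < k

/-- The coefficient `1` at the fixed points and at the smaller point of each two-element orbit. -/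
def openerCoeff {n : ℕ} (Ω : Type*) [Field Ω] (σ : Fin n → Fin n) (k : Fin n) : Ω :=
  if k ≤ σ k then 1 else 0

/-- If both squares are missing on an orbit of `σ`, then a one-dimensional torus acting on the
variables of this orbit fixes the form. -/
theorem HasShape.toralImage_infinite {n : ℕ} {Ω : Type*} [Field Ω] [Infinite Ω] {q : QForm n Ω}
    {σ : Fin n → Fin n} {ε : Fin n → Ω} (h : HasShape q σ ε) {i : Fin n} (hi : ε i = 0)
    (hσi : ε (σ i) = 0) : (toralImage q).Infinite := by
  have hinf : ({0}ᶜ : Set Ω).Infinite := (Set.finite_singleton 0).infinite_compl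
  let d : Ω → Fin n → Ω := fun t k => if k = i then t else if k = σ i then t⁻¹ else 1
  refine Set.infinite_of_injOn_mapsTo (f := d) (fun s _ t _ hst => ?_) (fun t ht => ?_) hinf
  · simpa [d] using congrFun hst i
  have ht : t ≠ 0 := ht
  refine mem_toralImage_of_diagonal (fun k => ?_) (fun k => ?_) (fun k l hkl => ?_)
  · simp only [d]; split_ifs <;> simp [ht]
  · rw [h.apply_single]
    by_cases h1 : k = i
    · subst h1; simp [hi]
    by_cases h2 : k = σ i
    · subst h2; simp [hσi]
    simp [d, h1, h2]
  · rw [h.polar_single]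
    by_cases hk : σ k = l
    · subst hk
      rw [if_pos ⟨hkl, rfl⟩, mul_one]
      by_cases h1 : k = i
      · subst h1; simp [d, hkl.symm, ht]
      by_cases h2 : k = σ i
      · subst h2; simp [d, h.involutive i, h1, ht]
      have h3 : σ k ≠ i := fun h' => h2 (by rw [← h', h.involutive])
      have h4 : σ k ≠ σ i := fun h' => h1 (h.involutive.injective h')
      simp [d, h1, h2, h3, h4]
    · simp [hk]

/-- The square at the larger point of every two-element orbit of `σ` is removed by a substitution
`x_a ↦ x_a + c x_{σ a}`, where `c` is a root of a quadratic polynomial. -/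
theorem HasShape.exists_act_upper {n : ℕ} {Ω : Type*} [Field Ω] [CharP Ω 2]
    (hΩ : IsQuadraticallyClosed Ω) {q : QForm n Ω} {σ : Fin n → Fin n} {ε : Fin n → Ω}
    (h : HasShape q σ ε) : ∃ b ∈ borelSubgroup n Ω, ∃ ε', HasShape (act b q) σ ε' ∧
      ∀ k, σ k < k → ε' k = 0 := by
  have hroot : ∀ k, ∃ c, ε (σ k) * c ^ 2 + 1 * c + ε k = 0 := by
    intro k
    by_cases h0 : ε (σ k) = 0
    · exact ⟨-ε k, by simp [h0]⟩
    · exact hΩ.exists_root h0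
  choose c₀ hc₀ using hroot
  let c : Fin n → Ω := fun k => if σ k < k then c₀ k else 0
  have hc : ∀ k, ¬ σ k < k → c k = 0 := fun k hk => if_neg hk
  have hv : IsTriangular fun k => (Pi.single k 1 + c k • Pi.single (σ k) 1 : Fin n → Ω) := by
    constructor
    · intro k i hki
      by_cases hk : σ k < k
      · simp [hki.ne', (hk.trans hki).ne']
      · simp [hki.ne', hc k hk]
    · intro k
      by_cases hk : σ k < k
      · simp [hk.ne']
      · simp [hc k hk]
  obtain ⟨b, hb, hbq, hbp⟩ := hv.exists_act q
  refine ⟨b, hb, _, ⟨h.involutive, fun i => rfl, fun i j => ?_⟩, fun k hk => ?_⟩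
  · rw [hbp]
    rcases eq_or_ne i j with rfl | hij
    · rw [polar_self_eq_zero, if_neg (by simp)]
    rw [QuadraticMap.polar_add_left, QuadraticMap.polar_add_right, QuadraticMap.polar_add_right,
      QuadraticMap.polar_smul_left, QuadraticMap.polar_smul_right, QuadraticMap.polar_smul_left,
      QuadraticMap.polar_smul_right]
    have h1 : QuadraticMap.polar q (Pi.single i 1) (Pi.single (σ j) 1) = 0 := by
      rw [h.polar_single, if_neg]
      exact fun h' => hij (h.involutive.injective h'.2)
    have h2 : QuadraticMap.polar q (Pi.single (σ i) 1) (Pi.single j 1) = 0 := by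
      rw [h.polar_single, if_neg]
      exact fun h' => hij (by rw [← h'.2, h.involutive])
    have h3 : c i • c j • QuadraticMap.polar q (Pi.single (σ i) 1) (Pi.single (σ j) 1) = 0 := by
      rw [h.polar_single]
      split_ifs with h'
      · have hσj : σ j = i := by rw [← h'.2, h.involutive]
        have hσi : σ i = j := by rw [← hσj, h.involutive]
        rcases lt_or_gt_of_ne hij with hlt | hlt
        · rw [hc i (by rw [hσi]; exact hlt.not_gt), zero_smul]
        · rw [hc j (by rw [hσj]; exact hlt.not_gt), zero_smul, smul_zero]
      · simp
    rw [h1, h2, h3, h.polar_single]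
    simp
  · rw [hbq, QuadraticMap.map_add q, QuadraticMap.map_smul, QuadraticMap.polar_smul_right,
      h.apply_single, h.apply_single, h.polar_single, if_pos ⟨hk.ne', rfl⟩]
    have := hc₀ k
    simp only [c, if_pos hk, smul_eq_mul]
    linear_combination this

/-- If the squares sit exactly at the fixed points and at the smaller points of the two-element
orbits, their coefficients can be scaled to `1`. -/
theorem HasShape.exists_act_openerCoeff {n : ℕ} {Ω : Type*} [Field Ω] [CharP Ω 2]
    (hΩ : IsQuadraticallyClosed Ω) {q : QForm n Ω} {σ : Fin n → Fin n} {ε : Fin n → Ω}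
    (h : HasShape q σ ε) (hupper : ∀ k, σ k < k → ε k = 0) (hlower : ∀ k, k ≤ σ k → ε k ≠ 0) :
    ∃ b ∈ borelSubgroup n Ω, HasShape (act b q) σ (openerCoeff Ω σ) := by
  choose s hs using fun k => hΩ.exists_mul_self (ε k)
  have hs0 : ∀ k, k ≤ σ k → s k ≠ 0 := fun k hk h0 => hlower k hk (by rw [← hs, h0, zero_mul])
  have hσ : ∀ k, ¬ k ≤ σ k → σ k ≤ σ (σ k) := fun k hk => by
    rw [h.involutive]; exact (not_le.mp hk).le
  let d : Fin n → Ω := fun k => if k ≤ σ k then (s k)⁻¹ else s (σ k)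
  have hd : ∀ k, d k ≠ 0 := by
    intro k
    simp only [d]
    split_ifs with hk
    · exact inv_ne_zero (hs0 k hk)
    · exact hs0 _ (hσ k hk)
  have hv : IsTriangular fun k => d k • (Pi.single k 1 : Fin n → Ω) :=
    ⟨fun k i h => by simp [h.ne'], fun k => by simpa using hd k⟩
  obtain ⟨b, hb, hbq, hbp⟩ := hv.exists_act q
  refine ⟨b, hb, h.involutive, fun k => ?_, fun i j => ?_⟩
  · rw [hbq, QuadraticMap.map_smul, h.apply_single, openerCoeff, smul_eq_mul]
    split_ifs with hk
    · have := hs0 k hk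
      simp only [d, if_pos hk]
      rw [← hs k]
      field_simp
    · rw [hupper k (not_le.mp hk), mul_zero]
  · rw [hbp, QuadraticMap.polar_smul_left, QuadraticMap.polar_smul_right, h.polar_single]
    split_ifs with hij
    · obtain ⟨hne, rfl⟩ := hij
      simp only [smul_eq_mul, mul_one, d, h.involutive i]
      rcases lt_or_gt_of_ne hne with hlt | hlt
      · rw [if_pos hlt.le, if_neg hlt.not_ge, inv_mul_cancel₀ (hs0 i hlt.le)]
      · rw [if_neg hlt.not_ge, if_pos hlt.le, mul_inv_cancel₀]
        exact hs0 _ (hσ i hlt.not_ge)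
    · simp

/-- A triangular substitution that keeps the polar form and removes all squares from an orbit of
`σ` shows that the toral image is infinite. -/
theorem HasShape.toralImage_infinite_of_isTriangular {n : ℕ} {Ω : Type*} [Field Ω] [CharP Ω 2]
    [Infinite Ω] {q : QForm n Ω} {σ : Fin n → Fin n} (h : HasShape q σ (openerCoeff Ω σ))
    {v : Fin n → Fin n → Ω} (hv : IsTriangular v) {k : Fin n}
    (hq : q (v k) = 0) (hqσ : q (v (σ k)) = 0)
    (hp : ∀ i j, i ≠ j → QuadraticMap.polar q (v i) (v j) = if σ i = j then 1 else 0) :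
    (toralImage q).Infinite := by
  obtain ⟨b, hb, hbq, hbp⟩ := hv.exists_act q
  have hshape : HasShape (act b q) σ fun i => q (v i) := by
    refine ⟨h.involutive, hbq, fun i j => ?_⟩
    rw [hbp]
    rcases eq_or_ne i j with rfl | hij
    · rw [polar_self_eq_zero, if_neg (by simp)]
    · simp [hp i j hij, hij]
  rw [← toralImage_act hb]
  exact hshape.toralImage_infinite hq hqσ

/-- If `q` has finite toral image then `σ` is non-nesting: otherwise the substitution
`x_f ↦ x_f + x_k`, for a fixed point `f` before `k`, or
`x_a ↦ x_a + x_b`, `x_{σ b} ↦ x_{σ b} + x_{σ a}`, for nested orbits `a < b < σ b < σ a`, removes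
a square. -/
theorem HasShape.isNonNestingInvolution {n : ℕ} {Ω : Type*} [Field Ω] [CharP Ω 2] [Infinite Ω]
    {q : QForm n Ω} {σ : Fin n → Fin n} (h : HasShape q σ (openerCoeff Ω σ))
    (hfin : (toralImage q).Finite) : IsNonNestingInvolution σ := by
  have h1 : ∀ k, k ≤ σ k → q (Pi.single k 1) = 1 := fun k hk => by
    rw [h.apply_single, openerCoeff, if_pos hk]
  have h0 : ∀ k, σ k < k → q (Pi.single k 1) = 0 := fun k hk => by
    rw [h.apply_single, openerCoeff, if_neg hk.not_ge]
  have hpol : ∀ i j, i ≠ j → QuadraticMap.polar q (Pi.single i 1) (Pi.single j 1) =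
      if σ i = j then 1 else 0 := fun i j hij => by rw [h.polar_single]; simp [hij]
  have hadd : (1 + 1 : Ω) = 0 := CharTwo.add_self_eq_zero 1
  refine ⟨h.involutive, fun a b hab hb hba => ?_, fun f k hf hfk => ?_⟩
  · have hσb : σ (σ b) = b := h.involutive b
    have hσa : σ (σ a) = a := h.involutive a
    have ha : a < σ a := hab.trans (hb.trans hba)
    let v : Fin n → Fin n → Ω := fun i => Pi.single i 1 +
      (if i = b then Pi.single a 1 else if i = σ a then Pi.single (σ b) 1 else 0)
    have hv : IsTriangular v := by
      constructor
      · intro i j hij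
        by_cases hib : i = b
        · subst hib; simp [v, hij.ne', (hab.trans hij).ne']
        by_cases hia : i = σ a
        · subst hia; simp [v, hij.ne', (hba.trans hij).ne', (hb.trans hba).ne']
        simp [v, hib, hia, hij.ne']
      · intro i
        by_cases hib : i = b
        · subst hib; simp [v, hab.ne']
        by_cases hia : i = σ a
        · subst hia; simp [v, hba.ne', (hb.trans hba).ne']
        simp [v, hib, hia]
    have hvb : v b = Pi.single b 1 + Pi.single a 1 := by simp [v]
    have hva : v (σ a) = Pi.single (σ a) 1 + Pi.single (σ b) 1 := by
      simp [v, (hb.trans hba).ne']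
    have hvk : ∀ k, k ≠ b → k ≠ σ a → v k = Pi.single k 1 := fun k h1 h2 => by simp [v, h1, h2]
    have hself : ∀ k, QuadraticMap.polar q (Pi.single k 1) (Pi.single k 1) = 0 := fun k =>
      polar_self_eq_zero q _
    refine h.toralImage_infinite_of_isTriangular hv (k := b) ?_ ?_ ?_ hfin
    · rw [hvb, QuadraticMap.map_add q, h1 b hb.le, h1 a ha.le, hadd, hpol b a hab.ne', if_neg,
        add_zero]
      exact (hab.trans hb).ne'
    · rw [hvk _ hb.ne' hba.ne, h0]
      rwa [hσb]
    · have key : ∀ i j, i < j → QuadraticMap.polar q (v i) (v j) = if σ i = j then 1 else 0 := by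
        intro i j hij
        have hii : ∀ k, σ i = k ↔ σ k = i := fun k =>
          ⟨fun h' => by rw [← h', h.involutive], fun h' => by rw [← h', h.involutive]⟩
        by_cases hjb : j = b
        · subst hjb
          have hia : i ≠ σ a := (hij.trans (hb.trans hba)).ne
          rw [hvb, hvk i hij.ne hia, QuadraticMap.polar_add_right, hpol i j hij.ne]
          rcases eq_or_ne i a with rfl | hne
          · rw [hself, add_zero]
          · rw [hpol i a hne, if_neg (show ¬ σ i = a from fun h' => hia ((hii a).mp h').symm),
              add_zero]
        by_cases hja : j = σ a
        · subst hja
          rw [hva]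
          by_cases hib : i = b
          · subst hib
            rw [hvb, QuadraticMap.polar_add_right, QuadraticMap.polar_add_left,
              QuadraticMap.polar_add_left, hpol _ _ hij.ne, hpol _ _ ha.ne, hpol _ _ hb.ne,
              hpol _ _ (hab.trans hb).ne, if_neg hba.ne, if_pos rfl, if_pos rfl,
              if_neg (h.involutive.injective.ne hab.ne)]
            simp [hadd]
          · rw [hvk i hib hij.ne, QuadraticMap.polar_add_right, hpol _ _ hij.ne]
            rcases eq_or_ne i (σ b) with rfl | hne
            · rw [hself, add_zero]
            · rw [hpol i _ hne, if_neg (show ¬ σ i = σ b from fun h' =>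
                hib (h.involutive.injective h')), add_zero]
        by_cases hib : i = b
        · subst hib
          rw [hvb, hvk j hjb hja, QuadraticMap.polar_add_left, hpol i j hij.ne,
            hpol a j (hab.trans hij).ne, if_neg (Ne.symm hja), add_zero]
        by_cases hia : i = σ a
        · subst hia
          rw [hva, hvk j hjb hja, QuadraticMap.polar_add_left, hpol _ j hij.ne,
            hpol _ j (hba.trans hij).ne, hσb, if_neg (Ne.symm hjb), add_zero]
        · rw [hvk i hib hia, hvk j hjb hja, hpol i j hij.ne]
      intro i j hij
      rcases lt_or_gt_of_ne hij with hlt | hlt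
      · exact key i j hlt
      · rw [QuadraticMap.polar_comm, key j i hlt]
        exact if_congr ⟨fun h' => by rw [← h', h.involutive], fun h' => by rw [← h', h.involutive]⟩
          rfl rfl
  · by_contra hk
    rw [not_lt] at hk
    let v : Fin n → Fin n → Ω := fun i => Pi.single i 1 + (if i = k then Pi.single f 1 else 0)
    have hv : IsTriangular v := by
      constructor
      · intro i j hij
        by_cases hik : i = k
        · subst hik; simp [v, hij.ne', (hfk.trans hij).ne']
        simp [v, hik, hij.ne']
      · intro i
        by_cases hik : i = k
        · subst hik; simp [v, hfk.ne']
        simp [v, hik]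
    have hf0 : ∀ j, QuadraticMap.polar q (Pi.single f 1) (Pi.single j 1) = 0 := by
      intro j
      rw [h.polar_single, hf, if_neg]
      exact fun h' => h'.1 h'.2
    have hf0' : ∀ j, QuadraticMap.polar q (Pi.single j 1) (Pi.single f 1) = 0 := fun j => by
      rw [QuadraticMap.polar_comm, hf0]
    have hvk : q (v k) = 0 := by
      simp [v, QuadraticMap.map_add, h1 k hk, h1 f hf.ge, hf0', hadd]
    refine h.toralImage_infinite_of_isTriangular hv hvk ?_ (fun i j hij => ?_) hfin
    · rcases hk.eq_or_lt with heq | hlt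
      · rwa [← heq]
      · simp [v, hlt.ne', h0 (σ k) (by rwa [h.involutive])]
    · rw [← hpol i j hij]
      simp only [v]
      split_ifs <;> simp [QuadraticMap.polar_add_left, QuadraticMap.polar_add_right, hf0, hf0']

/-- A form with finite toral image lies in the Borel orbit of the form of a non-nesting
involution. -/
theorem exists_isNonNestingInvolution {n : ℕ} {Ω : Type*} [Field Ω] [CharP Ω 2]
    (hΩ : IsQuadraticallyClosed Ω) {q : QForm n Ω} (hfin : (toralImage q).Finite) :
    ∃ b ∈ borelSubgroup n Ω, ∃ σ, IsNonNestingInvolution σ ∧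
      HasShape (act b q) σ (openerCoeff Ω σ) := by
  have := hΩ.infinite
  obtain ⟨b₁, hb₁, σ, ε₁, h₁⟩ := exists_hasShape q
  obtain ⟨b₂, hb₂, ε₂, h₂, hup⟩ := h₁.exists_act_upper hΩ
  have hfin₂ : (toralImage (act b₂ (act b₁ q))).Finite := by
    rwa [toralImage_act hb₂, toralImage_act hb₁]
  obtain ⟨b₃, hb₃, h₃⟩ := h₂.exists_act_openerCoeff hΩ hup fun k hk h0 => by
    refine h₂.toralImage_infinite h0 ?_ hfin₂
    rcases hk.eq_or_lt with heq | hlt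
    · rwa [← heq]
    · exact hup _ (by rwa [h₂.involutive])
  have hfin₃ := hfin₂
  rw [← toralImage_act hb₃] at hfin₃
  refine ⟨b₁ * b₂ * b₃, mul_mem (mul_mem hb₁ hb₂) hb₃, σ, h₃.isNonNestingInvolution hfin₃, ?_⟩
  rwa [act_mul, act_mul]

/-! ### Uniqueness of the involution, and triviality of the toral image -/

theorem apply_self_ne_zero_of_mem_borelSubgroup {n : ℕ} {Ω : Type*} [Field Ω] {b : GL (Fin n) Ω}
    (hb : b ∈ borelSubgroup n Ω) (k : Fin n) : (b : Matrix (Fin n) (Fin n) Ω) k k ≠ 0 := by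
  intro h
  have := borel_mul_diag hb (inv_mem hb) k
  rw [h, zero_mul, mul_inv_cancel] at this
  simp at this

theorem HasShape.polar_apply {n : ℕ} {Ω : Type*} [Field Ω] {q : QForm n Ω} {σ : Fin n → Fin n}
    {ε : Fin n → Ω} (h : HasShape q σ ε) (v : Fin n → Ω) (k : Fin n) :
    QuadraticMap.polar q v (Pi.single k 1) = if σ k ≠ k then v (σ k) else 0 := by
  have hv : v = ∑ i, v i • (Pi.single i 1 : Fin n → Ω) := by
    simpa using (pi_eq_sum_univ' v)
  have hsum : QuadraticMap.polar q v (Pi.single k 1) =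
      ∑ i, v i * QuadraticMap.polar q (Pi.single i 1) (Pi.single k 1) := by
    conv_lhs => rw [hv]
    have := map_sum ((QuadraticMap.polarBilin q).flip (Pi.single k 1))
      (fun i => v i • (Pi.single i 1 : Fin n → Ω)) Finset.univ
    simpa only [LinearMap.flip_apply, QuadraticMap.polarBilin_apply_apply,
      QuadraticMap.polar_smul_left, smul_eq_mul] using this
  rw [hsum, Finset.sum_eq_single (σ k)]
  · rw [h.polar_single, h.involutive]
    by_cases hk : σ k = k <;> simp [hk]
  · intro i _ hi
    rw [h.polar_single, if_neg, mul_zero]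
    rintro ⟨-, rfl⟩
    exact hi (h.involutive i).symm
  · simp

/-- The identity `P b = b⁻ᵀ Q` of partial permutation matrices, entrywise. -/
theorem HasShape.apply_eq_inv_apply {n : ℕ} {Ω : Type*} [Field Ω] {p : QForm n Ω}
    {σ τ : Fin n → Fin n} {ε η : Fin n → Ω} {b : GL (Fin n) Ω} (hp : HasShape p σ ε)
    (hq : HasShape (act b p) τ η) {k : Fin n} (hk : σ k ≠ k) (i : Fin n) :
    (b : Matrix (Fin n) (Fin n) Ω) (σ k) i =
      if τ i ≠ i then ((b⁻¹ : GL (Fin n) Ω) : Matrix (Fin n) (Fin n) Ω) (τ i) k else 0 := by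
  have h1 := hp.polar_apply ((b : Matrix (Fin n) (Fin n) Ω).col i) k
  have h2 := hq.polar_apply (((b⁻¹ : GL (Fin n) Ω) : Matrix (Fin n) (Fin n) Ω).col k) i
  rw [if_pos hk] at h1
  rw [polar_act, Matrix.mulVec_single_one, ← Matrix.mulVec_single_one _ k, Matrix.mulVec_mulVec,
    ← Units.val_mul, mul_inv_cancel, Units.val_one, Matrix.one_mulVec, QuadraticMap.polar_comm,
    h1, Matrix.mulVec_single_one] at h2
  exact h2

/-- The diagonal entry of `b` at `σ k` is an entry of `b⁻¹` in row `τ (σ k)` and column `k`, which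
can be nonzero only on or above the diagonal. -/
theorem HasShape.apply_apply_le {n : ℕ} {Ω : Type*} [Field Ω] {p : QForm n Ω}
    {σ τ : Fin n → Fin n} {ε η : Fin n → Ω} {b : GL (Fin n) Ω} (hb : b ∈ borelSubgroup n Ω)
    (hp : HasShape p σ ε) (hq : HasShape (act b p) τ η) {k : Fin n} (hk : σ k ≠ k) :
    τ (σ k) ≠ σ k ∧ τ (σ k) ≤ k := by
  have h := hp.apply_eq_inv_apply hq hk (σ k)
  have h0 := apply_self_ne_zero_of_mem_borelSubgroup hb (σ k)
  rw [h] at h0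
  refine ⟨fun h' => h0 (by simp [h']), not_lt.mp fun hlt => h0 ?_⟩
  rw [inv_mem hb _ _ hlt]
  simp

/-- The involution is an invariant of the Borel orbit: for two involutions `σ` and `τ` occurring in
the same orbit, `τ ∘ σ` is a permutation with `τ (σ k) ≤ k`, hence the identity. -/
theorem HasShape.unique {n : ℕ} {Ω : Type*} [Field Ω] {p : QForm n Ω}
    {σ τ : Fin n → Fin n} {ε η : Fin n → Ω} {b : GL (Fin n) Ω} (hb : b ∈ borelSubgroup n Ω)
    (hp : HasShape p σ ε) (hq : HasShape (act b p) τ η) : σ = τ := by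
  have hp' : HasShape (act b⁻¹ (act b p)) σ ε := by rwa [← act_mul, mul_inv_cancel, act_one]
  have h1 : ∀ k, σ k ≠ k → τ k ≠ k := by
    intro k hk
    have hσk : σ (σ k) ≠ σ k := fun h => hk (hp.involutive.injective h)
    have := (hp.apply_apply_le hb hq hσk).1
    rwa [hp.involutive] at this
  have h2 : ∀ k, τ k ≠ k → σ k ≠ k := by
    intro k hk
    have hτk : τ (τ k) ≠ τ k := fun h => hk (hq.involutive.injective h)
    have := (hq.apply_apply_le (inv_mem hb) hp' hτk).1
    rwa [hq.involutive] at this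
  have hle : ∀ k, τ (σ k) ≤ k := by
    intro k
    by_cases hk : σ k = k
    · rw [hk, not_not.mp fun h => h2 k h hk]
    · exact (hp.apply_apply_le hb hq hk).2
  have hid : ∀ k, τ (σ k) = k := by
    intro k
    induction k using WellFoundedLT.induction with | _ k ih
    by_contra hne
    exact hne (hp.involutive.injective (hq.involutive.injective
      (ih _ (lt_of_le_of_ne (hle k) hne))))
  funext k
  rw [← hq.involutive (σ k), hid]

/-- For a non-nesting involution, a stabilizing matrix is diagonal in the columns of the fixed
points and of the smaller points of two-element orbits. -/
theorem IsNonNestingInvolution.apply_eq_zero {n : ℕ} {Ω : Type*} [Field Ω] {q : QForm n Ω}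
    {σ : Fin n → Fin n} {ε : Fin n → Ω} (hσ : IsNonNestingInvolution σ) (h : HasShape q σ ε)
    {b : GL (Fin n) Ω} (hb : b ∈ borelSubgroup n Ω) (hbq : act b q = q) {i a : Fin n}
    (hi : i ≤ σ i) (hai : a ≠ i) : (b : Matrix (Fin n) (Fin n) Ω) a i = 0 := by
  rcases lt_or_gt_of_ne hai with hlt | hlt
  swap
  · exact hb a i hlt
  by_cases ha : σ a = a
  · exact absurd (hσ.lt_of_fixed a i ha hlt) hi.not_gt
  have hσa : σ (σ a) ≠ σ a := fun h' => ha (hσ.involutive.injective h')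
  have hrel := h.apply_eq_inv_apply (b := b) (by rwa [hbq]) hσa i
  rw [hσ.involutive] at hrel
  rw [hrel]
  split_ifs with hfix
  · refine inv_mem hb _ _ ?_
    have hi' : i < σ i := lt_of_le_of_ne hi (Ne.symm hfix)
    by_contra hle
    rw [not_lt] at hle
    exact hσ.not_nested a i hlt hi'
      (lt_of_le_of_ne hle fun h' => hlt.ne' (hσ.involutive.injective h'))
  · rfl

/-- The stabilizer of the form of a non-nesting involution is unipotent. -/
theorem IsNonNestingInvolution.toralImage_eq {n : ℕ} {Ω : Type*} [Field Ω] [CharP Ω 2]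
    {q : QForm n Ω} {σ : Fin n → Fin n} (hσ : IsNonNestingInvolution σ)
    (h : HasShape q σ (openerCoeff Ω σ)) : toralImage q = {1} := by
  refine Set.Subset.antisymm ?_ ?_
  · rintro d ⟨b, hb, hbq, rfl⟩
    have key : ∀ c ∈ borelSubgroup n Ω, act c q = q → ∀ i, i ≤ σ i →
        (c : Matrix (Fin n) (Fin n) Ω) i i = 1 := by
      intro c hc hcq i hi
      have hcol : (c : Matrix (Fin n) (Fin n) Ω).col i =
          (c : Matrix (Fin n) (Fin n) Ω) i i • Pi.single i 1 := by
        funext a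
        by_cases hai : a = i
        · subst hai; simp [Matrix.col]
        · simpa [hai] using hσ.apply_eq_zero h hc hcq hi hai
      have h1 := act_apply_single c q i
      rw [hcq, hcol, QuadraticMap.map_smul, h.apply_single, openerCoeff, if_pos hi, smul_eq_mul,
        mul_one] at h1
      rcases mul_self_eq_one_iff.mp h1.symm with h2 | h2
      · exact h2
      · rw [h2, CharTwo.neg_eq]
    have hbq' : act b⁻¹ q = q := by
      conv_lhs => rw [← hbq, ← act_mul, mul_inv_cancel, act_one]
    refine Set.mem_singleton_iff.mpr (funext fun k => ?_)
    rcases le_or_gt k (σ k) with hk | hk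
    · exact key b hb hbq k hk
    · have hle : σ k ≤ σ (σ k) := by rw [hσ.involutive]; exact hk.le
      have hrel := h.apply_eq_inv_apply (b := b⁻¹) (k := k) (by rwa [hbq']) hk.ne (σ k)
      rw [key b⁻¹ (inv_mem hb) hbq' _ hle, hσ.involutive, if_pos hk.ne', inv_inv] at hrel
      simpa using hrel.symm
  · rintro _ rfl
    exact ⟨1, one_mem _, act_one q, by ext k; simp⟩

theorem IsNonNestingInvolution.bRank_eq {n : ℕ} {Ω : Type*} [Field Ω] [CharP Ω 2]
    {q : QForm n Ω} {σ : Fin n → Fin n} (hσ : IsNonNestingInvolution σ)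
    (h : HasShape q σ (openerCoeff Ω σ)) : bRank (borelOrbit q) = n := by
  rw [bRank_borelOrbit_eq_iff, hσ.toralImage_eq h, zariskiDim_singleton]

/-! ### Involutions, matchings and normal forms -/

theorem IsNonNestingInvolution.card_fixed_le_one {n : ℕ} {σ : Fin n → Fin n}
    (hσ : IsNonNestingInvolution σ) : (Finset.univ.filter fun k => σ k = k).card ≤ 1 := by
  rw [Finset.card_le_one]
  intro a ha b hb
  simp only [Finset.mem_filter, Finset.mem_univ, true_and] at ha hb
  rcases lt_trichotomy a b with h | h | h
  · exact absurd (hσ.lt_of_fixed a b ha h) (by rw [hb]; exact lt_irrefl b)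
  · exact h
  · exact absurd (hσ.lt_of_fixed b a hb h) (by rw [ha]; exact lt_irrefl a)

theorem two_mul_card_le_apply {n : ℕ} {σ : Fin n → Fin n} (hσ : Function.Involutive σ) :
    2 * (Finset.univ.filter fun k => k ≤ σ k).card =
      n + (Finset.univ.filter fun k => σ k = k).card := by
  have h1 : (Finset.univ.filter fun k => k ≤ σ k).card =
      (Finset.univ.filter fun k => k < σ k).card + (Finset.univ.filter fun k => σ k = k).card := by
    rw [← Finset.card_union_of_disjoint]
    · congr 1
      ext k
      simp [le_iff_lt_or_eq, eq_comm]
    · rw [Finset.disjoint_filter]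
      exact fun k _ h h' => h.ne' h'
  have h2 : (Finset.univ.filter fun k => k < σ k).card =
      (Finset.univ.filter fun k => ¬ k ≤ σ k).card := by
    refine Finset.card_bij (fun k _ => σ k) (fun k hk => ?_) (fun k _ l _ h => hσ.injective h)
      (fun k hk => ⟨σ k, ?_, hσ k⟩)
    · simpa [hσ k] using hk
    · simpa [hσ k] using hk
  have h3 := Finset.card_filter_add_card_filter_not (s := Finset.univ) (fun k => k ≤ σ k)
  rw [Finset.card_univ, Fintype.card_fin] at h3
  omega

/-- A non-nesting involution of an `n`-element set has a fixed point exactly if `n` is odd. -/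
theorem IsNonNestingInvolution.parity {n : ℕ} {σ : Fin n → Fin n} (hσ : IsNonNestingInvolution σ) :
    (∀ f, σ f = f → 2 * ((n + 1) / 2) = n + 1) ∧
      ((∀ f, σ f ≠ f) → 2 * ((n + 1) / 2) = n) := by
  have h1 := hσ.card_fixed_le_one
  have h2 := two_mul_card_le_apply hσ.involutive
  constructor
  · intro f hf
    have : 0 < (Finset.univ.filter fun k => σ k = k).card :=
      Finset.card_pos.mpr ⟨f, by simpa using hf⟩
    omega
  · intro hf
    have : (Finset.univ.filter fun k => σ k = k).card = 0 := by simpa using hf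
    omega

/-- The pairs `a < σ a` together with the pairs `(f, n)` for the fixed points `f` of `σ`. -/
def involutionMatching {n : ℕ} (N : ℕ) (σ : Fin n → Fin n) : Finset (Fin N × Fin N) :=
  Finset.univ.filter fun p => ∃ a : Fin n, (a : ℕ) = p.1 ∧ a ≤ σ a ∧
    (p.2 : ℕ) = if σ a = a then n else (σ a : ℕ)

theorem mem_involutionMatching {n N : ℕ} {σ : Fin n → Fin n} {p : Fin N × Fin N} :
    p ∈ involutionMatching N σ ↔ ∃ a : Fin n, (a : ℕ) = p.1 ∧ a ≤ σ a ∧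
      (p.2 : ℕ) = if σ a = a then n else (σ a : ℕ) := by
  simp [involutionMatching]

theorem IsNonNestingInvolution.isNonNestingMatching {n : ℕ} {σ : Fin n → Fin n}
    (hσ : IsNonNestingInvolution σ) :
    IsNonNestingMatching (involutionMatching (2 * ((n + 1) / 2)) σ) := by
  obtain ⟨hfix, hnfix⟩ := hσ.parity
  have hlt : ∀ a : Fin n, a ≤ σ a → (a : ℕ) < if σ a = a then n else (σ a : ℕ) := by
    intro a ha
    split_ifs with h
    · exact a.2
    · exact lt_of_le_of_ne ha fun h' => h (Fin.ext h'.symm)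
  refine ⟨?_, ?_, ?_⟩
  · intro p hp
    obtain ⟨a, h1, h2, h3⟩ := mem_involutionMatching.mp hp
    rw [Fin.lt_def, ← h1, h3]
    exact hlt a h2
  · intro v
    have huniq : ∀ a : Fin n, a ≤ σ a → ((v : ℕ) = a ∨ (v : ℕ) = if σ a = a then n else (σ a : ℕ)) →
        (∀ a' : Fin n, a' ≤ σ a' → ((v : ℕ) = a' ∨ (v : ℕ) = if σ a' = a' then n else (σ a' : ℕ)) →
          a' = a) →
        ∃! p, p ∈ involutionMatching (2 * ((n + 1) / 2)) σ ∧ (v = p.1 ∨ v = p.2) := by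
      intro a ha hv huniq
      have hs : (if σ a = a then n else (σ a : ℕ)) < 2 * ((n + 1) / 2) := by
        split_ifs with h
        · have := hfix a h; omega
        · have := (σ a).2; omega
      refine ⟨(⟨a, by omega⟩, ⟨_, hs⟩), ⟨mem_involutionMatching.mpr ⟨a, rfl, ha, rfl⟩, ?_⟩, ?_⟩
      · exact hv.imp Fin.ext Fin.ext
      · rintro p ⟨hp, hvp⟩
        obtain ⟨a', h1, h2, h3⟩ := mem_involutionMatching.mp hp
        have : a' = a := huniq a' h2 (hvp.imp (fun h => by rw [h, h1]) fun h => by rw [h, h3])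
        subst this
        exact Prod.ext (Fin.ext h1.symm) (Fin.ext h3)
    by_cases hvn : (v : ℕ) < n
    · obtain ⟨k, hk⟩ : ∃ k : Fin n, (k : ℕ) = v := ⟨⟨v, hvn⟩, rfl⟩
      rw [← hk] at huniq
      by_cases hle : k ≤ σ k
      · refine huniq k hle (Or.inl rfl) fun a' ha' h => ?_
        rcases h with h | h
        · exact (Fin.ext h).symm
        · split_ifs at h with h'
          · omega
          · have h : k = σ a' := Fin.ext h
            rw [h, hσ.involutive] at hle
            exact (h.trans (le_antisymm hle ha')).symm
      · have hlt' : σ k < σ (σ k) := by rw [hσ.involutive]; exact not_le.mp hle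
        refine huniq (σ k) hlt'.le (Or.inr ?_) fun a' ha' h => ?_
        · rw [if_neg hlt'.ne', hσ.involutive]
        · rcases h with h | h
          · rw [← Fin.ext h] at ha'; exact absurd ha' hle
          · split_ifs at h with h'
            · omega
            · rw [Fin.ext h, hσ.involutive]
    · obtain ⟨f, hf⟩ : ∃ f, σ f = f := by
        by_contra hno
        have := hnfix (not_exists.mp hno)
        omega
      have hv : (v : ℕ) = n := by
        have := hfix f hf
        omega
      refine huniq f hf.ge (Or.inr (by rw [if_pos hf, hv])) fun a' ha' h => ?_
      rcases h with h | h
      · omega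
      · split_ifs at h with h'
        · exact Finset.card_le_one.mp hσ.card_fixed_le_one _ (by simpa using h') _
            (by simpa using hf)
        · omega
  · intro p hp p' hp' ⟨hlt1, hlt2⟩
    obtain ⟨a, h1, h2, h3⟩ := mem_involutionMatching.mp hp
    obtain ⟨b, h1', h2', h3'⟩ := mem_involutionMatching.mp hp'
    rw [Fin.lt_def, ← h1, ← h1'] at hlt1
    rw [Fin.lt_def, h3, h3'] at hlt2
    have hab : a < b := hlt1
    have hb : ¬ σ b = b := by
      intro h
      rw [if_pos h] at hlt2
      split_ifs at hlt2 <;> omega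
    have hb' : b < σ b := lt_of_le_of_ne h2' (Ne.symm hb)
    rw [if_neg hb] at hlt2
    split_ifs at hlt2 with ha
    · exact absurd (hσ.lt_of_fixed a b ha hab) hb'.not_gt
    · exact hσ.not_nested a b hab hb' hlt2

theorem IsNonNestingMatching.exists_partner {N : ℕ} {M : Finset (Fin N × Fin N)}
    (hM : IsNonNestingMatching M) : ∃ τ : Fin N → Fin N, Function.Involutive τ ∧ (∀ v, τ v ≠ v) ∧
      ∀ p, p ∈ M ↔ p.1 < p.2 ∧ τ p.1 = p.2 := by
  choose P hP huniq using hM.perfect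
  have hfst : ∀ p ∈ M, P p.1 = p := fun p hp => (huniq p.1 p ⟨hp, Or.inl rfl⟩).symm
  have hsnd : ∀ p ∈ M, P p.2 = p := fun p hp => (huniq p.2 p ⟨hp, Or.inr rfl⟩).symm
  let τ : Fin N → Fin N := fun v => if v = (P v).1 then (P v).2 else (P v).1
  have h1 : ∀ p ∈ M, τ p.1 = p.2 := fun p hp => by simp [τ, hfst p hp]
  have h2 : ∀ p ∈ M, τ p.2 = p.1 := fun p hp => by simp [τ, hsnd p hp, (hM.lt p hp).ne']
  refine ⟨τ, fun v => ?_, fun v => ?_, fun p => ⟨fun hp => ⟨hM.lt p hp, h1 p hp⟩, ?_⟩⟩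
  · obtain ⟨hv, h | h⟩ := hP v
    · rw [h, h1 _ hv, h2 _ hv]
    · rw [h, h2 _ hv, h1 _ hv]
  · obtain ⟨hv, h | h⟩ := hP v
    · rw [h, h1 _ hv]; exact (hM.lt _ hv).ne'
    · rw [h, h2 _ hv]; exact (hM.lt _ hv).ne
  · rintro ⟨hlt, hp⟩
    obtain ⟨hv, h | h⟩ := hP p.1
    · have h' := h1 _ hv
      rw [← h, hp] at h'
      rw [show p = P p.1 from Prod.ext h h']
      exact hv
    · have h' := h2 _ hv
      rw [← h, hp] at h'
      have := hM.lt _ hv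
      rw [← h, ← h'] at this
      exact absurd this hlt.not_gt

theorem IsNonNestingMatching.exists_involution {n N : ℕ} (hN : n ≤ N) (hN' : N ≤ n + 1)
    {M : Finset (Fin N × Fin N)} (hM : IsNonNestingMatching M) :
    ∃ σ : Fin n → Fin n, IsNonNestingInvolution σ ∧ M = involutionMatching N σ := by
  obtain ⟨τ, hτ, hτne, hMτ⟩ := hM.exists_partner
  have hnest : ∀ a b, a < b → b < τ b → ¬ τ b < τ a := fun a b hab hb hba =>
    hM.not_nested (a, τ a) ((hMτ _).mpr ⟨hab.trans (hb.trans hba), rfl⟩) (b, τ b)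
      ((hMτ _).mpr ⟨hb, rfl⟩) ⟨hab, hba⟩
  let ι : Fin n → Fin N := Fin.castLE hN
  let σ : Fin n → Fin n := fun k => if h : (τ (ι k) : ℕ) < n then ⟨τ (ι k), h⟩ else k
  have hσ1 : ∀ k, (τ (ι k) : ℕ) < n → ι (σ k) = τ (ι k) := fun k h => by
    ext; simp [σ, ι, h]
  have hσ2 : ∀ k, ¬ (τ (ι k) : ℕ) < n → σ k = k := fun k h => by
    simp [σ, h]
  have hinj : Function.Injective ι := Fin.castLE_injective hN
  have hfix : ∀ k, σ k = k ↔ ¬ (τ (ι k) : ℕ) < n := by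
    intro k
    refine ⟨fun h h' => hτne (ι k) ?_, hσ2 k⟩
    rw [← hσ1 k h', h]
  have hmono : ∀ a b, ι a < ι b ↔ a < b := fun a b => Iff.rfl
  refine ⟨σ, ⟨fun k => ?_, fun a b hab hb hba => ?_, fun f k hf hfk => ?_⟩, Finset.ext fun p => ?_⟩
  · by_cases h : (τ (ι k) : ℕ) < n
    · apply hinj
      have h' := hσ1 k h
      rw [hσ1 (σ k), h', hτ]
      rw [h', hτ]
      exact k.2
    · rw [hσ2 k h, hσ2 k h]
  · have h1 : (τ (ι b) : ℕ) < n := not_not.mp fun h => hb.ne' ((hfix b).mpr h)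
    have h2 : (τ (ι a) : ℕ) < n := not_not.mp fun h => by
      rw [(hfix a).mpr h] at hba
      exact absurd (hab.trans (hb.trans hba)) (lt_irrefl _)
    rw [← hmono, hσ1 b h1] at hb
    rw [← hmono, hσ1 b h1, hσ1 a h2] at hba
    exact hnest _ _ hab hb hba
  · have hfn : (τ (ι f) : ℕ) = n := by
      have := (hfix f).mp hf
      omega
    have hk : (τ (ι k) : ℕ) < n := by
      by_contra h
      have h' : (τ (ι k) : ℕ) = n := by omega
      have := hτ.injective (Fin.ext (hfn.trans h'.symm))
      exact hfk.ne (hinj this)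
    rw [← hmono, hσ1 k hk]
    by_contra h
    refine hnest (ι f) (ι k) hfk (lt_of_le_of_ne (not_lt.mp h) (hτne _).symm) ?_
    rw [Fin.lt_def, hfn]
    exact hk
  · rw [hMτ, mem_involutionMatching]
    constructor
    · rintro ⟨hlt, hp⟩
      have hpn : (p.1 : ℕ) < n := by rw [Fin.lt_def] at hlt; omega
      obtain ⟨a, ha⟩ : ∃ a, ι a = p.1 := ⟨⟨p.1, hpn⟩, rfl⟩
      rw [← ha] at hp hlt
      refine ⟨a, by rw [← ha]; rfl, ?_, ?_⟩
      · by_cases h : (τ (ι a) : ℕ) < n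
        · rw [← hp, ← hσ1 a h] at hlt
          exact le_of_lt hlt
        · rw [hσ2 a h]
      · by_cases h : (τ (ι a) : ℕ) < n
        · rw [if_neg (mt (hfix a).mp (not_not.mpr h)), ← hp, ← hσ1 a h]
          rfl
        · rw [if_pos (hσ2 a h), ← hp]
          omega
    · rintro ⟨a, h1, h2, h3⟩
      have ha : ι a = p.1 := Fin.ext h1
      rw [← ha]
      by_cases h : (τ (ι a) : ℕ) < n
      · have hne := mt (hfix a).mp (not_not.mpr h)
        rw [if_neg hne] at h3
        have hp2 : p.2 = ι (σ a) := Fin.ext h3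
        rw [hp2, hσ1 a h]
        refine ⟨?_, rfl⟩
        rw [← hσ1 a h]
        exact lt_of_le_of_ne h2 fun h' => hne (hinj h'.symm)
      · rw [if_pos (hσ2 a h)] at h3
        refine ⟨?_, Fin.ext ?_⟩
        · rw [Fin.lt_def, h3]; exact a.2
        · omega

/-! ### The forms of involutions, matchings and normal data -/

theorem mon_apply {n : ℕ} {Ω : Type*} [Field Ω] (i j : Fin n) (v : Fin n → Ω) :
    (mon i j : QForm n Ω) v = v i * v j := rfl

theorem polar_mon {n : ℕ} {Ω : Type*} [Field Ω] (i j : Fin n) (v w : Fin n → Ω) :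
    QuadraticMap.polar (mon i j : QForm n Ω) v w = v i * w j + w i * v j := by
  simp only [QuadraticMap.polar, mon_apply, Pi.add_apply]
  ring

theorem QForm.polar_add {n : ℕ} {Ω : Type*} [Field Ω] (p q : QForm n Ω) (v w : Fin n → Ω) :
    QuadraticMap.polar (p + q : QForm n Ω) v w =
      QuadraticMap.polar p v w + QuadraticMap.polar q v w := by
  simp only [QuadraticMap.polar, add_apply]
  ring

theorem QForm.polar_zero {n : ℕ} {Ω : Type*} [Field Ω] (v w : Fin n → Ω) :
    QuadraticMap.polar (0 : QForm n Ω) v w = 0 := by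
  simp [QuadraticMap.polar]

theorem QForm.polar_sum {n : ℕ} {Ω : Type*} [Field Ω] {ι : Type*} (s : Finset ι) (f : ι → QForm n Ω)
    (v w : Fin n → Ω) : QuadraticMap.polar (∑ t ∈ s, f t : QForm n Ω) v w =
      ∑ t ∈ s, QuadraticMap.polar (f t) v w := by
  simp [QuadraticMap.polar, Finset.sum_sub_distrib]

theorem HasShape.eq {n : ℕ} {Ω : Type*} [Field Ω] {p q : QForm n Ω} {σ : Fin n → Fin n}
    {ε : Fin n → Ω} (hp : HasShape p σ ε) (hq : HasShape q σ ε) : p = q :=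
  QForm.ext_basis (fun i => by rw [hp.apply_single, hq.apply_single])
    fun i j _ => by rw [hp.polar_single, hq.polar_single]

/-- The form `∑ (x_a² + x_a x_{σ a})` over the pairs `a < σ a`, plus `x_f²` for the fixed points
`f` of `σ`. -/
def involutionForm {n : ℕ} (Ω : Type*) [Field Ω] (σ : Fin n → Fin n) : QForm n Ω :=
  ∑ a with a ≤ σ a, (mon a a + if σ a = a then 0 else mon a (σ a))

theorem hasShape_involutionForm {n : ℕ} {Ω : Type*} [Field Ω] [CharP Ω 2] {σ : Fin n → Fin n}
    (hσ : Function.Involutive σ) : HasShape (involutionForm Ω σ) σ (openerCoeff Ω σ) := by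
  refine ⟨hσ, fun k => ?_, fun k l => ?_⟩
  · have hterm : ∀ a, (mon a a + if σ a = a then 0 else mon a (σ a) : QForm n Ω) (Pi.single k 1) =
        if a = k then 1 else 0 := by
      intro a
      rw [add_apply, mon_apply]
      by_cases h : a = k
      · subst h
        rw [if_pos rfl]
        split_ifs with h'
        · simp
        · simp [mon_apply, h']
      · split_ifs <;> simp [mon_apply, h]
    rw [involutionForm, sum_apply, Finset.sum_congr rfl fun a _ => hterm a,
      Finset.sum_ite_eq']
    simp [openerCoeff]
  · rcases eq_or_ne k l with rfl | hkl
    · rw [polar_self_eq_zero, if_neg (by simp)]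
    have hterm : ∀ a, QuadraticMap.polar
        (mon a a + if σ a = a then 0 else mon a (σ a) : QForm n Ω) (Pi.single k 1) (Pi.single l 1) =
        (if a = k then (if σ k = l then 1 else 0) else 0) +
          (if a = l then (if σ k = l then 1 else 0) else 0) := by
      intro a
      rw [QForm.polar_add, polar_mon]
      by_cases hak : a = k
      · subst hak
        rw [if_pos rfl, if_neg hkl]
        by_cases h1 : σ a = a
        · rw [if_pos h1, QForm.polar_zero]; simp [hkl, h1]
        · simp [polar_mon, hkl, h1, Pi.single_apply]
      · rw [if_neg hak]
        by_cases hal : a = l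
        · subst hal
          have hiff : σ k = a ↔ σ a = k :=
            ⟨fun h => by rw [← h, hσ], fun h => by rw [← h, hσ]⟩
          rw [if_pos rfl, if_congr hiff rfl rfl]
          by_cases h1 : σ a = a
          · rw [if_pos h1, QForm.polar_zero]; simp [hak, h1]
          · simp [polar_mon, hak, h1, Pi.single_apply]
        · by_cases h1 : σ a = a
          · rw [if_pos h1, QForm.polar_zero]; simp [hak, hal]
          · simp [polar_mon, hak, hal, h1]
    rw [involutionForm, QForm.polar_sum, Finset.sum_congr rfl fun a _ => hterm a,
      Finset.sum_add_distrib, Finset.sum_ite_eq', Finset.sum_ite_eq']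
    by_cases h : σ k = l
    · subst h
      rcases lt_or_gt_of_ne hkl with hlt | hlt
      · simp [hσ k, hlt.le, hlt.not_ge, hkl]
      · simp [hσ k, hlt.le, hlt.not_ge, hkl]
    · simp [h]

theorem matchingForm_involutionMatching {n N : ℕ} (Ω : Type*) [Field Ω] {σ : Fin n → Fin n}
    (hN : n ≤ N) (hfix : ∀ f, σ f = f → n < N) :
    matchingForm n Ω (involutionMatching N σ) = involutionForm Ω σ := by
  have hs : ∀ a, (if σ a = a then n else (σ a : ℕ)) < N := by
    intro a
    split_ifs with h
    · exact hfix a h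
    · exact (σ a).2.trans_le hN
  symm
  refine Finset.sum_bij (fun a _ => (⟨a, a.2.trans_le hN⟩, ⟨_, hs a⟩)) (fun a ha => ?_)
    (fun a _ b _ hab => ?_) (fun p hp => ?_) (fun a _ => ?_)
  · exact mem_involutionMatching.mpr ⟨a, rfl, (Finset.mem_filter.mp ha).2, rfl⟩
  · exact Fin.ext (congrArg (fun p : Fin N × Fin N => (p.1 : ℕ)) hab)
  · obtain ⟨a, h1, h2, h3⟩ := mem_involutionMatching.mp hp
    exact ⟨a, by simpa using h2, Prod.ext (Fin.ext h1) (Fin.ext h3.symm)⟩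
  · ext v
    by_cases h : σ a = a
    · simp [coordForm, h, mon_apply]
    · simp [coordForm, h, mon_apply]

/-- Normal data for the form of a non-nesting involution: the components are indexed by the points
`a ≤ σ a`. -/
def IsNonNestingInvolution.normalData {n : ℕ} {σ : Fin n → Fin n}
    (hσ : IsNonNestingInvolution σ) : NormalData n where
  r := (Finset.univ.filter fun a => a ≤ σ a).card
  i := (Finset.univ.filter fun a => a ≤ σ a).orderEmbOfFin rfl
  j t := σ ((Finset.univ.filter fun a => a ≤ σ a).orderEmbOfFin rfl t)
  ε _ := true
  δ t := decide (σ ((Finset.univ.filter fun a => a ≤ σ a).orderEmbOfFin rfl t) ≠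
    (Finset.univ.filter fun a => a ≤ σ a).orderEmbOfFin rfl t)
  ne_zero _ := Or.inl rfl
  disjoint := by
    intro s t hst
    have hle : ∀ t, (Finset.univ.filter fun a => a ≤ σ a).orderEmbOfFin rfl t ≤
        σ ((Finset.univ.filter fun a => a ≤ σ a).orderEmbOfFin rfl t) := fun t =>
      (Finset.mem_filter.mp (Finset.orderEmbOfFin_mem _ rfl t)).2
    have hne := ((Finset.univ.filter fun a => a ≤ σ a).orderEmbOfFin rfl).injective.ne hst
    have hs := hle s
    have ht := hle t
    have hσσ := hσ.involutive
    generalize (Finset.univ.filter fun a => a ≤ σ a).orderEmbOfFin rfl s = a at *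
    generalize (Finset.univ.filter fun a => a ≤ σ a).orderEmbOfFin rfl t = b at *
    have h1 : σ a ≠ b := by
      rintro rfl
      rw [hσσ] at ht
      exact hne (le_antisymm hs ht)
    have h2 : σ a ≠ σ b := fun h => hne (hσσ.injective h)
    have h3 : a ≠ σ b := fun h => h1 (by rw [h, hσσ])
    simp [hne.symm, h1.symm, h2.symm, h3.symm]
  j_eq_iff t := by simp
  i_strictMono := OrderEmbedding.strictMono _
  i_le_j t := (Finset.mem_filter.mp (Finset.orderEmbOfFin_mem _ rfl t)).2
  c1 := by
    intro t _ ht s hts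
    have hlt := hσ.lt_of_fixed _ _ (by simpa using ht)
      (((Finset.univ.filter fun a => a ≤ σ a).orderEmbOfFin rfl).strictMono hts)
    exact absurd (Finset.mem_filter.mp (Finset.orderEmbOfFin_mem _ rfl s)).2 hlt.not_ge
  c2 _ _ _ h1 h2 h3 _ := hσ.not_nested _ _ h1 h2 h3

theorem IsNonNestingInvolution.form_normalData {n : ℕ} (Ω : Type*) [Field Ω] {σ : Fin n → Fin n}
    (hσ : IsNonNestingInvolution σ) : hσ.normalData.form Ω = involutionForm Ω σ := by
  rw [involutionForm, ← Finset.sum_coe_sort, NormalData.form]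
  refine Fintype.sum_equiv ((Finset.univ.filter fun a => a ≤ σ a).orderIsoOfFin rfl).toEquiv _ _
    fun t => ?_
  simp only [NormalData.component, normalData, if_true, decide_eq_true_eq, ite_not]
  rfl

namespace NormalData

variable {n : ℕ} (D : NormalData n)

theorem disjoint_iff {s t : Fin D.r} (hst : s ≠ t) :
    D.i s ≠ D.i t ∧ D.i s ≠ D.j t ∧ D.j s ≠ D.i t ∧ D.j s ≠ D.j t := by
  have h := D.disjoint s t hst
  simp only [Set.disjoint_insert_left, Set.disjoint_singleton_left, Set.mem_insert_iff,
    Set.mem_singleton_iff, not_or] at h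
  exact ⟨h.1.1, h.1.2, h.2.1, h.2.2⟩

/-- The involution that interchanges `i_t` and `j_t`, and fixes the variables that do not occur. -/
theorem exists_involution : ∃ σ : Fin n → Fin n, Function.Involutive σ ∧
    (∀ t, σ (D.i t) = D.j t) ∧ (∀ t, σ (D.j t) = D.i t) ∧
    ∀ k, (∀ t, D.i t ≠ k ∧ D.j t ≠ k) → σ k = k := by
  classical
  let σ : Fin n → Fin n := fun k =>
    if h : ∃ t, D.i t = k then D.j h.choose else if h : ∃ t, D.j t = k then D.i h.choose else k
  have hi : ∀ t, σ (D.i t) = D.j t := by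
    intro t
    have h : ∃ s, D.i s = D.i t := ⟨t, rfl⟩
    have hs : h.choose = t := by
      by_contra hne
      exact (D.disjoint_iff hne).1 h.choose_spec
    simp only [σ, dif_pos h, hs]
  have hj : ∀ t, σ (D.j t) = D.i t := by
    intro t
    by_cases h : ∃ s, D.i s = D.j t
    · obtain ⟨s, hs⟩ := h
      have hst : s = t := by
        by_contra hne
        exact (D.disjoint_iff hne).2.1 hs
      subst hst
      rw [← hs, hi, hs]
    · have h' : ∃ s, D.j s = D.j t := ⟨t, rfl⟩
      have hs : h'.choose = t := by
        by_contra hne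
        exact (D.disjoint_iff hne).2.2.2 h'.choose_spec
      simp only [σ, dif_neg h, dif_pos h', hs]
  have hk : ∀ k, (∀ t, D.i t ≠ k ∧ D.j t ≠ k) → σ k = k := by
    intro k h
    simp only [σ]
    rw [dif_neg fun ⟨t, ht⟩ => (h t).1 ht, dif_neg fun ⟨t, ht⟩ => (h t).2 ht]
  refine ⟨σ, fun k => ?_, hi, hj, hk⟩
  by_cases h1 : ∃ t, D.i t = k
  · obtain ⟨t, rfl⟩ := h1
    rw [hi, hj]
  by_cases h2 : ∃ t, D.j t = k
  · obtain ⟨t, rfl⟩ := h2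
    rw [hj, hi]
  have := hk k fun t => ⟨fun h => h1 ⟨t, h⟩, fun h => h2 ⟨t, h⟩⟩
  rw [this, this]

theorem component_apply_single (Ω : Type*) [Field Ω] (t : Fin D.r) (k : Fin n) :
    D.component Ω t (Pi.single k 1) = if D.i t = k ∧ D.ε t = true then 1 else 0 := by
  have hj := D.j_eq_iff t
  rw [component, add_apply]
  by_cases hk : D.i t = k
  · subst hk
    cases hδ : D.δ t <;> cases hε : D.ε t <;> simp_all [mon_apply]
  · split_ifs <;> simp_all [mon_apply]

theorem polar_component (Ω : Type*) [Field Ω] {t : Fin D.r} {k l : Fin n}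
    (hkl : k ≠ l) : QuadraticMap.polar (D.component Ω t) (Pi.single k 1) (Pi.single l 1) =
      if D.i t = k ∧ D.j t = l ∨ D.i t = l ∧ D.j t = k then 1 else 0 := by
  have hj := D.j_eq_iff t
  have hδ : (D.i t = k ∧ D.j t = l ∨ D.i t = l ∧ D.j t = k) → D.δ t = true := by
    intro h
    by_contra hδ
    rw [Bool.not_eq_true, ← hj] at hδ
    rw [hδ] at h
    rcases h with h | h
    · exact hkl (h.1.symm.trans h.2)
    · exact hkl (h.2.symm.trans h.1)
  have hsq : QuadraticMap.polar (if D.ε t = true then mon (D.i t) (D.i t) else 0 : QForm n Ω)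
      (Pi.single k 1) (Pi.single l 1) = 0 := by
    split_ifs
    · rw [polar_mon]
      by_cases hk : D.i t = k
      · subst hk; simp [hkl]
      · simp [hk]
    · exact QForm.polar_zero _ _
  rw [component, QForm.polar_add, hsq, zero_add]
  split_ifs with h1 h2 h2
  · rw [polar_mon]
    rcases h2 with ⟨rfl, rfl⟩ | ⟨rfl, rfl⟩ <;> simp [hkl, hkl.symm]
  · rw [polar_mon]
    simp only [Pi.single_apply]
    push Not at h2
    by_cases hk : D.i t = k
    · simp [hk, h2.1 hk, hkl]
    · by_cases hl : D.i t = l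
      · simp [hl, h2.2 hl, hkl.symm]
      · simp [hk, hl]
  · exact absurd (hδ h2) h1
  · exact QForm.polar_zero _ _

theorem hasShape_form {Ω : Type*} [Field Ω] [CharP Ω 2] {σ : Fin n → Fin n}
    (hσ : Function.Involutive σ) (hi : ∀ t, σ (D.i t) = D.j t)
    (hk : ∀ k, (∀ t, D.i t ≠ k ∧ D.j t ≠ k) → σ k = k) :
    HasShape (D.form Ω) σ fun k => if ∃ t, D.i t = k ∧ D.ε t = true then 1 else 0 := by
  refine ⟨hσ, fun k => ?_, fun k l => ?_⟩
  · rw [form, sum_apply, Finset.sum_congr rfl fun t _ =>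
      D.component_apply_single Ω t k]
    split_ifs with h
    · obtain ⟨t, rfl, ht⟩ := h
      rw [Finset.sum_eq_single t]
      · simp [ht]
      · intro s _ hst
        rw [if_neg fun h => hst (D.i_strictMono.injective h.1)]
      · simp
    · exact Finset.sum_eq_zero fun t _ => if_neg fun h' => h ⟨t, h'⟩
  · rcases eq_or_ne k l with rfl | hkl
    · rw [polar_self_eq_zero, if_neg (by simp)]
    rw [form, QForm.polar_sum, Finset.sum_congr rfl fun t _ => D.polar_component Ω hkl]
    split_ifs with h
    · obtain ⟨t, ht⟩ : ∃ t, D.i t = k ∧ D.j t = l ∨ D.i t = l ∧ D.j t = k := by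
        by_contra hno
        push Not at hno
        refine hkl ?_
        rw [← h.2]
        refine (hk k fun t => ⟨fun h' => (hno t).1 h' ?_, fun h' => (hno t).2 ?_ h'⟩).symm
        · rw [← hi, h', h.2]
        · rw [← h.2, ← h', ← hi, hσ]
      rw [Finset.sum_eq_single t, if_pos ht]
      · intro s _ hst
        have hd := D.disjoint_iff hst
        rw [if_neg]
        rintro (⟨h1, h2⟩ | ⟨h1, h2⟩) <;> rcases ht with ⟨h3, h4⟩ | ⟨h3, h4⟩
        · exact hd.1 (h1.trans h3.symm)
        · exact hd.2.1 (h1.trans h4.symm)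
        · exact hd.2.1 (h1.trans h4.symm)
        · exact hd.1 (h1.trans h3.symm)
      · simp
    · refine Finset.sum_eq_zero fun t _ => if_neg ?_
      rintro (⟨rfl, rfl⟩ | ⟨rfl, rfl⟩)
      · exact h ⟨hkl, hi t⟩
      · exact h ⟨hkl, by rw [← hi, hσ]⟩

/-- In a normal form of maximal `B`-rank all squares `x_{i_t}²` and all variables occur, and the
pairs `{i_t, j_t}` are the orbits of a non-nesting involution. -/
theorem exists_isNonNestingInvolution {Ω : Type*} [Field Ω] [CharP Ω 2]
    (hΩ : IsQuadraticallyClosed Ω) (h : bRank (borelOrbit (D.form Ω)) = n) :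
    ∃ σ : Fin n → Fin n, IsNonNestingInvolution σ ∧ D.form Ω = involutionForm Ω σ ∧
      (∀ t, σ (D.i t) = D.j t) ∧ (∀ t, D.ε t = true) ∧ ∀ k, k ≤ σ k → ∃ t, D.i t = k := by
  have := hΩ.infinite
  obtain ⟨σ, hσ, hi, hj, hk⟩ := D.exists_involution
  have hshape := D.hasShape_form (Ω := Ω) hσ hi hk
  have hfin := toralImage_finite_of_bRank_eq h
  set ε : Fin n → Ω := fun k => if ∃ t, D.i t = k ∧ D.ε t = true then 1 else 0 with hε
  have hup : ∀ k, σ k < k → ε k = 0 := by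
    intro k hk'
    refine if_neg ?_
    rintro ⟨t, rfl, -⟩
    rw [hi] at hk'
    exact absurd (D.i_le_j t) hk'.not_ge
  have hlow : ∀ k, k ≤ σ k → ∃ t, D.i t = k ∧ D.ε t = true := by
    intro k hle
    by_contra hno
    have h0 : ε k = 0 := if_neg hno
    refine hshape.toralImage_infinite h0 ?_ hfin
    rcases hle.eq_or_lt with heq | hlt
    · rwa [← heq]
    · exact hup _ (by rwa [hσ])
  have heq : ε = openerCoeff Ω σ := by
    funext k
    rw [openerCoeff]
    split_ifs with hle
    · exact if_pos (hlow k hle)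
    · exact hup k (not_le.mp hle)
  rw [heq] at hshape
  refine ⟨σ, hshape.isNonNestingInvolution hfin, hshape.eq (hasShape_involutionForm hσ), hi,
    fun t => ?_, fun k hle => ?_⟩
  · obtain ⟨s, hs, hsε⟩ := hlow (D.i t) (by rw [hi]; exact D.i_le_j t)
    rwa [← D.i_strictMono.injective hs]
  · obtain ⟨t, ht, -⟩ := hlow k hle
    exact ⟨t, ht⟩

/-- The number of components of a normal form of maximal `B`-rank, and their shape: the last
component is a square exactly if `n` is odd, and the others are `x_i² + x_i x_j`. -/
theorem shape_of_bRank_eq {Ω : Type*} [Field Ω] [CharP Ω 2]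
    (hΩ : IsQuadraticallyClosed Ω) (h : bRank (borelOrbit (D.form Ω)) = n) :
    D.r = n / 2 + (if Odd n then 1 else 0) ∧
      (∀ t : Fin D.r, (t : ℕ) < n / 2 →
        D.i t < D.j t ∧ D.component Ω t = mon (D.i t) (D.i t) + mon (D.i t) (D.j t)) ∧
      (∀ t : Fin D.r, (t : ℕ) = n / 2 → D.component Ω t = mon (D.i t) (D.i t)) := by
  obtain ⟨σ, hσ, -, hi, hε, hex⟩ := D.exists_isNonNestingInvolution hΩ h
  have hr : (Finset.univ.filter fun k => k ≤ σ k).card = D.r := by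
    rw [show (Finset.univ.filter fun k => k ≤ σ k) = Finset.univ.image D.i from ?_,
      Finset.card_image_of_injective _ D.i_strictMono.injective, Finset.card_univ, Fintype.card_fin]
    ext k
    simp only [Finset.mem_filter, Finset.mem_univ, true_and, Finset.mem_image]
    refine ⟨hex k, ?_⟩
    rintro ⟨t, rfl⟩
    rw [hi]
    exact D.i_le_j t
  have h1 := hσ.card_fixed_le_one
  have h2 := two_mul_card_le_apply hσ.involutive
  rw [hr] at h2
  have hlast : ∀ t : Fin D.r, D.δ t = false → (t : ℕ) + 1 = D.r := by
    intro t ht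
    by_contra hne
    let s : Fin D.r := ⟨t + 1, by omega⟩
    have hlt : t < s := Fin.lt_def.mpr (Nat.lt_succ_self _)
    have := hσ.lt_of_fixed (D.i t) (D.i s) (by rw [hi, D.j_eq_iff, ht]) (D.i_strictMono hlt)
    rw [hi] at this
    exact absurd (D.i_le_j s) this.not_ge
  have hodd : ∀ t : Fin D.r, D.δ t = false → 2 * D.r = n + 1 := by
    intro t ht
    have : 0 < (Finset.univ.filter fun k => σ k = k).card :=
      Finset.card_pos.mpr ⟨D.i t, by simp [hi, D.j_eq_iff, ht]⟩
    omega
  refine ⟨?_, fun t ht => ?_, fun t ht => ?_⟩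
  · split_ifs with hn
    · obtain ⟨m, hm⟩ := hn
      omega
    · obtain ⟨m, hm⟩ := Nat.not_odd_iff_even.mp hn
      omega
  · have hδ : D.δ t = true := by
      by_contra hδ
      rw [Bool.not_eq_true] at hδ
      have := hlast t hδ
      have := hodd t hδ
      omega
    refine ⟨lt_of_le_of_ne (D.i_le_j t) fun heq => ?_, by simp [component, hε, hδ]⟩
    have := (D.j_eq_iff t).mp heq.symm
    simp [hδ] at this
  · have hpos : 0 < (Finset.univ.filter fun k => σ k = k).card := by
      have := t.2
      omega
    obtain ⟨f, hf⟩ := Finset.card_pos.mp hpos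
    have hf : σ f = f := by simpa using hf
    obtain ⟨s, rfl⟩ := hex f hf.ge
    have hs : D.δ s = false := by rw [← D.j_eq_iff, ← hi, hf]
    have hst : s = t := by
      have := hlast s hs
      have := hodd s hs
      exact Fin.ext (by omega)
    subst hst
    simp [component, hε, hs]

end NormalData

/-! ### Counting non-nesting matchings -/

theorem count_take_ofFn {α : Type*} [DecidableEq α] {N : ℕ} (f : Fin N → α) (x : α) (i : ℕ) :
    ((List.ofFn f).take i).count x =
      (Finset.univ.filter fun k : Fin N => (k : ℕ) < i ∧ f k = x).card := by
  induction i with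
  | zero => simp
  | succ i ih =>
    by_cases hi : i < N
    · have hset : (Finset.univ.filter fun k : Fin N => (k : ℕ) < i + 1 ∧ f k = x) =
          (Finset.univ.filter fun k : Fin N => (k : ℕ) < i ∧ f k = x) ∪
            (Finset.univ.filter fun k : Fin N => k = ⟨i, hi⟩ ∧ f k = x) := by
        ext k
        simp only [Finset.mem_filter, Finset.mem_univ, true_and, Finset.mem_union, Fin.ext_iff,
          Nat.lt_succ_iff, le_iff_lt_or_eq, or_and_right]
      have hdisj : Disjoint (Finset.univ.filter fun k : Fin N => (k : ℕ) < i ∧ f k = x)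
          (Finset.univ.filter fun k : Fin N => k = ⟨i, hi⟩ ∧ f k = x) := by
        rw [Finset.disjoint_filter]
        rintro k _ ⟨h1, -⟩ ⟨rfl, -⟩
        exact lt_irrefl _ h1
      rw [hset, Finset.card_union_of_disjoint hdisj, ← ih,
        List.take_succ_eq_append_getElem (by simpa using hi), List.count_append, List.getElem_ofFn,
        List.count_singleton]
      congr 1
      by_cases hx : f ⟨i, hi⟩ = x
      · rw [if_pos (by simpa using hx), Finset.filter_congr (q := fun k => k = ⟨i, hi⟩) fun k _ =>
          ⟨fun h => h.1, fun h => ⟨h, h ▸ hx⟩⟩, Finset.filter_eq',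
          if_pos (Finset.mem_univ _), Finset.card_singleton]
      · rw [if_neg (by simpa using hx), eq_comm, Finset.card_eq_zero, Finset.filter_eq_empty_iff]
        rintro k _ ⟨rfl, h⟩
        exact hx h
    · rw [List.take_of_length_le (by simp; omega), ← List.take_of_length_le (i := i)
        (l := List.ofFn f) (by simp; omega), ih]
      congr 1
      ext k
      have := k.2
      simp only [Finset.mem_filter, Finset.mem_univ, true_and]
      exact ⟨fun h => ⟨by omega, h.2⟩, fun h => ⟨by omega, h.2⟩⟩

theorem count_ofFn {α : Type*} [DecidableEq α] {N : ℕ} (f : Fin N → α) (x : α) :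
    (List.ofFn f).count x = (Finset.univ.filter fun k : Fin N => f k = x).card := by
  rw [← List.take_of_length_le (i := N) (l := List.ofFn f) (by simp), count_take_ofFn]
  simp

/-- A set `A` of positions such that the word with an up-step at the positions in `A` and a
down-step elsewhere is a Dyck word. -/
def IsBallot {N : ℕ} (A : Finset (Fin N)) : Prop :=
  A.card = Aᶜ.card ∧ ∀ i : ℕ, (Finset.univ.filter fun v : Fin N => (v : ℕ) < i ∧ v ∉ A).card ≤
    (Finset.univ.filter fun v : Fin N => (v : ℕ) < i ∧ v ∈ A).card

/-- The word with an up-step at the positions in `A` and a down-step elsewhere. -/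
def stepList {N : ℕ} (A : Finset (Fin N)) : List DyckStep :=
  List.ofFn fun v => if v ∈ A then DyckStep.U else DyckStep.D

theorem count_take_stepList {N : ℕ} (A : Finset (Fin N)) (i : ℕ) :
    ((stepList A).take i).count DyckStep.U =
        (Finset.univ.filter fun v : Fin N => (v : ℕ) < i ∧ v ∈ A).card ∧
      ((stepList A).take i).count DyckStep.D =
        (Finset.univ.filter fun v : Fin N => (v : ℕ) < i ∧ v ∉ A).card := by
  rw [stepList, count_take_ofFn, count_take_ofFn]
  constructor <;>
  · congr 1
    ext v
    by_cases h : v ∈ A <;> simp [h]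

theorem count_stepList {N : ℕ} (A : Finset (Fin N)) :
    (stepList A).count DyckStep.U = A.card ∧ (stepList A).count DyckStep.D = Aᶜ.card := by
  rw [stepList, count_ofFn, count_ofFn]
  constructor <;>
  · congr 1
    ext v
    by_cases h : v ∈ A <;> simp [h]

theorem ncard_isBallot (m : ℕ) : {A : Finset (Fin (2 * m)) | IsBallot A}.ncard = catalan m := by
  have hcard : ∀ A : Finset (Fin (2 * m)), IsBallot A → A.card = m := by
    intro A hA
    have h1 := hA.1
    have h2 := A.card_add_card_compl
    rw [Fintype.card_fin] at h2
    omega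
  let w : {A : Finset (Fin (2 * m)) // IsBallot A} → {p : DyckWord // p.semilength = m} := fun A =>
    ⟨⟨stepList A.1, by rw [(count_stepList A.1).1, (count_stepList A.1).2, A.2.1], fun i => by
        rw [(count_take_stepList A.1 i).1, (count_take_stepList A.1 i).2]
        exact A.2.2 i⟩, by
      rw [DyckWord.semilength, (count_stepList A.1).1, hcard A.1 A.2]⟩
  have hw : Function.Bijective w := by
    constructor
    · intro A B hAB
      have h : stepList A.1 = stepList B.1 := congrArg (fun p => p.1.toList) hAB
      have h := List.ofFn_injective h
      refine Subtype.ext (Finset.ext fun v => ?_)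
      have hv := congrFun h v
      by_cases h1 : v ∈ A.1 <;> by_cases h2 : v ∈ B.1 <;> simp_all
    · rintro ⟨p, hp⟩
      have hlen : p.toList.length = 2 * m := by rw [← p.two_mul_semilength_eq_length, hp]
      let A : Finset (Fin (2 * m)) :=
        Finset.univ.filter fun v => p.toList[(v : ℕ)]'(by rw [hlen]; exact v.2) = DyckStep.U
      have hA : stepList A = p.toList := by
        refine List.ext_getElem (by simp [stepList, hlen]) fun i h1 h2 => ?_
        simp only [stepList, List.getElem_ofFn, A, Finset.mem_filter, Finset.mem_univ, true_and]
        split_ifs with h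
        · exact h.symm
        · exact ((DyckStep.dichotomy _).resolve_left h).symm
      refine ⟨⟨A, ?_, fun i => ?_⟩, Subtype.ext (DyckWord.ext hA)⟩
      · rw [← (count_stepList A).1, ← (count_stepList A).2, hA, p.count_U_eq_count_D]
      · rw [← (count_take_stepList A i).1, ← (count_take_stepList A i).2, hA]
        exact p.count_D_le_count_U i
  rw [← DyckWord.card_dyckWord_semilength_eq_catalan, ← Nat.card_eq_fintype_card,
    ← Nat.card_congr (Equiv.ofBijective w hw)]
  exact (Nat.card_coe_set_eq _).symm

/-- The smaller points of the pairs of a matching. -/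
def openers {N : ℕ} (M : Finset (Fin N × Fin N)) : Finset (Fin N) := M.image Prod.fst

theorem mem_openers_iff {N : ℕ} {M : Finset (Fin N × Fin N)} {τ : Fin N → Fin N}
    (hM : ∀ p, p ∈ M ↔ p.1 < p.2 ∧ τ p.1 = p.2) (v : Fin N) : v ∈ openers M ↔ v < τ v := by
  rw [openers, Finset.mem_image]
  constructor
  · rintro ⟨p, hp, rfl⟩
    obtain ⟨h1, h2⟩ := (hM p).mp hp
    rwa [h2]
  · exact fun h => ⟨(v, τ v), (hM _).mpr ⟨h, rfl⟩, rfl⟩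

theorem IsNonNestingMatching.isBallot_openers {N : ℕ} {M : Finset (Fin N × Fin N)}
    (hM : IsNonNestingMatching M) : IsBallot (openers M) := by
  obtain ⟨τ, hτ, hne, hMτ⟩ := hM.exists_partner
  have hmem := mem_openers_iff hMτ
  have hmem' : ∀ v, v ∉ openers M ↔ τ v < v := fun v => by
    rw [hmem, not_lt]
    exact ⟨fun h => lt_of_le_of_ne h (hne v), le_of_lt⟩
  constructor
  · refine Finset.card_bij (fun v _ => τ v) (fun v hv => ?_) (fun v _ w _ h => hτ.injective h)
      fun v hv => ⟨τ v, ?_, hτ v⟩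
    · rw [Finset.mem_compl, hmem', hτ]
      exact (hmem v).mp hv
    · rw [hmem, hτ]
      exact (hmem' v).mp (Finset.mem_compl.mp hv)
  · intro i
    refine Finset.card_le_card_of_injOn τ (fun v hv => ?_) hτ.injective.injOn
    simp only [Finset.coe_filter, Finset.mem_univ, true_and, Set.mem_ofPred_eq] at hv ⊢
    rw [hmem'] at hv
    rw [hmem, hτ]
    exact ⟨lt_trans (Fin.lt_def.mp hv.2) hv.1, hv.2⟩

/-- In a non-nesting matching the partners of the smaller points are in the same order as these
points, so the matching is determined by its smaller points. -/
theorem injOn_openers (N : ℕ) :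
    Set.InjOn openers {M : Finset (Fin N × Fin N) | IsNonNestingMatching M} := by
  intro M hM M' hM' heq
  obtain ⟨τ, hτ, hne, hMτ⟩ := IsNonNestingMatching.exists_partner hM
  obtain ⟨τ', hτ', hne', hMτ'⟩ := IsNonNestingMatching.exists_partner hM'
  have hA := mem_openers_iff hMτ
  have hA' := mem_openers_iff hMτ'
  have hiff : ∀ v, v < τ v ↔ v < τ' v := fun v => by rw [← hA, ← hA', heq]
  -- The common part of the two symmetric cases at the smallest point where the partners differ.
  have key : ∀ ρ ρ' : Fin N → Fin N, Function.Involutive ρ → Function.Involutive ρ' →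
      (∀ v, ρ' v ≠ v) →
      (∀ a b, a < b → b < ρ' b → ¬ ρ' b < ρ' a) → (∀ v, v < ρ v ↔ v < ρ' v) →
      ∀ a, a < ρ a → (∀ b < a, b < ρ b → ρ b = ρ' b) → ¬ ρ a < ρ' a := by
    intro ρ ρ' hρ hρ' hne' hnest hiff a ha hind hlt
    have hc : ρ' (ρ a) < ρ a := by
      have : ¬ ρ a < ρ (ρ a) := by rw [hρ]; exact ha.not_gt
      rw [hiff, not_lt] at this
      exact lt_of_le_of_ne this (hne' _)
    have hc' : ρ' (ρ a) < ρ' (ρ' (ρ a)) := by rwa [hρ']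
    have hlt' : ρ' (ρ a) < a := by
      rcases lt_trichotomy (ρ' (ρ a)) a with h | h | h
      · exact h
      · rw [← h, hρ', h] at hlt
        exact absurd hlt (lt_irrefl _)
      · exact absurd (by rwa [hρ']) (hnest a _ h hc')
    have h := hind _ hlt' ((hiff _).mpr hc')
    rw [hρ'] at h
    exact hlt'.ne (hρ.injective h)
  have hnest : ∀ a b, a < b → b < τ b → ¬ τ b < τ a := fun a b hab hb hba =>
    hM.not_nested (a, τ a) ((hMτ _).mpr ⟨hab.trans (hb.trans hba), rfl⟩) (b, τ b)
      ((hMτ _).mpr ⟨hb, rfl⟩) ⟨hab, hba⟩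
  have hnest' : ∀ a b, a < b → b < τ' b → ¬ τ' b < τ' a := fun a b hab hb hba =>
    hM'.not_nested (a, τ' a) ((hMτ' _).mpr ⟨hab.trans (hb.trans hba), rfl⟩) (b, τ' b)
      ((hMτ' _).mpr ⟨hb, rfl⟩) ⟨hab, hba⟩
  have hττ' : ∀ a, a < τ a → τ a = τ' a := by
    intro a
    induction a using WellFoundedLT.induction with | _ a ih
    intro ha
    refine le_antisymm (not_lt.mp ?_) (not_lt.mp ?_)
    · exact key τ' τ hτ' hτ hne hnest (fun v => (hiff v).symm) a ((hiff a).mp ha)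
        fun b hb hb' => (ih b hb ((hiff b).mpr hb')).symm
    · exact key τ τ' hτ hτ' hne' hnest' hiff a ha ih
  ext p
  rw [hMτ, hMτ']
  constructor
  · rintro ⟨h1, h2⟩
    exact ⟨h1, by rw [← hττ' _ (by rwa [h2]), h2]⟩
  · rintro ⟨h1, h2⟩
    exact ⟨h1, by rw [hττ' _ ((hiff _).mpr (by rwa [h2])), h2]⟩

/-- The `k`-th element of `A` is matched with the `k`-th element of the complement. -/
theorem IsBallot.exists_isNonNestingMatching {N : ℕ} {A : Finset (Fin N)} (hA : IsBallot A) :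
    ∃ M : Finset (Fin N × Fin N), IsNonNestingMatching M ∧ openers M = A := by
  let a := A.orderEmbOfFin rfl
  let c := Aᶜ.orderEmbOfFin hA.1.symm
  have ha : ∀ k, a k ∈ A := fun k => Finset.orderEmbOfFin_mem _ rfl k
  have hc : ∀ k, c k ∉ A := fun k => Finset.mem_compl.mp (Finset.orderEmbOfFin_mem _ hA.1.symm k)
  have ha' : ∀ v ∈ A, ∃ k, a k = v := fun v hv => by
    have : v ∈ Set.range a := by rw [Finset.range_orderEmbOfFin]; exact hv
    exact this
  have hc' : ∀ v ∉ A, ∃ k, c k = v := fun v hv => by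
    have : v ∈ Set.range c := by rw [Finset.range_orderEmbOfFin]; simpa using hv
    exact this
  have hlt : ∀ k, a k < c k := by
    intro k
    by_contra hle
    rw [not_lt] at hle
    -- Up to position `c k` there are at least `k + 1` down-steps and at most `k` up-steps.
    have h := hA.2 (c k + 1)
    have h1 : (k : ℕ) + 1 ≤
        (Finset.univ.filter fun v : Fin N => (v : ℕ) < c k + 1 ∧ v ∉ A).card := by
      rw [← Fin.card_Iic]
      refine Finset.card_le_card_of_injOn c (fun j hj => ?_) c.injective.injOn
      have hj : j ≤ k := by simpa using hj
      simpa [hc j, Nat.lt_succ_iff] using c.monotone hj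
    have h2 : (Finset.univ.filter fun v : Fin N => (v : ℕ) < c k + 1 ∧ v ∈ A).card ≤ k := by
      rw [← Fin.card_Iio k, ← Finset.card_image_of_injective _ a.injective]
      refine Finset.card_le_card fun v hv => ?_
      simp only [Finset.mem_filter, Finset.mem_univ, true_and, Nat.lt_succ_iff] at hv
      obtain ⟨j, rfl⟩ := ha' v hv.2
      refine Finset.mem_image_of_mem _ (Finset.mem_Iio.mpr ?_)
      have h3 : a j < a k := lt_of_le_of_ne (le_trans (Fin.le_def.mpr hv.1) hle) fun h' => by
        have h4 : c k = a k := le_antisymm hle (h' ▸ Fin.le_def.mpr hv.1)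
        exact hc k (h4 ▸ ha k)
      exact a.lt_iff_lt.mp h3
    omega
  refine ⟨Finset.univ.image fun k => (a k, c k), ⟨?_, fun v => ?_, ?_⟩, ?_⟩
  · intro p hp
    obtain ⟨k, -, rfl⟩ := Finset.mem_image.mp hp
    exact hlt k
  · by_cases hv : v ∈ A
    · obtain ⟨k, rfl⟩ := ha' v hv
      refine ⟨(a k, c k), ⟨Finset.mem_image_of_mem _ (Finset.mem_univ k), Or.inl rfl⟩, ?_⟩
      rintro p ⟨hp, hvp⟩
      obtain ⟨j, -, rfl⟩ := Finset.mem_image.mp hp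
      rcases hvp with h | h
      · rw [a.injective h]
      · exact absurd (show c j ∈ A from (show a k = c j from h) ▸ ha k) (hc j)
    · obtain ⟨k, rfl⟩ := hc' v hv
      refine ⟨(a k, c k), ⟨Finset.mem_image_of_mem _ (Finset.mem_univ k), Or.inr rfl⟩, ?_⟩
      rintro p ⟨hp, hvp⟩
      obtain ⟨j, -, rfl⟩ := Finset.mem_image.mp hp
      rcases hvp with h | h
      · exact absurd (show c k ∈ A from (show c k = a j from h) ▸ ha j) (hc k)
      · rw [c.injective h]
  · rintro p hp p' hp' ⟨h1, h2⟩
    obtain ⟨j, -, rfl⟩ := Finset.mem_image.mp hp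
    obtain ⟨k, -, rfl⟩ := Finset.mem_image.mp hp'
    exact absurd (a.lt_iff_lt.mp h1) (c.lt_iff_lt.mp h2).not_gt
  · rw [openers, Finset.image_image]
    exact Finset.image_orderEmbOfFin_univ A rfl

theorem ncard_isNonNestingMatching (m : ℕ) :
    {M : Finset (Fin (2 * m) × Fin (2 * m)) | IsNonNestingMatching M}.ncard = catalan m := by
  have hbij : Set.BijOn openers
      {M : Finset (Fin (2 * m) × Fin (2 * m)) | IsNonNestingMatching M} {A | IsBallot A} :=
    ⟨fun M hM => IsNonNestingMatching.isBallot_openers hM, injOn_openers _,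
      fun A hA => IsBallot.exists_isNonNestingMatching hA⟩
  rw [← ncard_isBallot, ← hbij.image_eq, hbij.injOn.ncard_image]

/-! ### The orbits of maximal `B`-rank -/

theorem IsNonNestingMatching.exists_hasShape {n : ℕ} (Ω : Type*) [Field Ω] [CharP Ω 2]
    {M : Finset (Fin (2 * ((n + 1) / 2)) × Fin (2 * ((n + 1) / 2)))}
    (hM : IsNonNestingMatching M) : ∃ σ : Fin n → Fin n, IsNonNestingInvolution σ ∧
      M = involutionMatching _ σ ∧ matchingForm n Ω M = involutionForm Ω σ := by
  obtain ⟨σ, hσ, rfl⟩ := hM.exists_involution (n := n) (by omega) (by omega)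
  exact ⟨σ, hσ, rfl, matchingForm_involutionMatching Ω (by omega) fun f hf => by
    have := hσ.parity.1 f hf
    omega⟩

theorem IsNonNestingInvolution.exists_matchingForm_eq {n : ℕ} (Ω : Type*) [Field Ω]
    {σ : Fin n → Fin n} (hσ : IsNonNestingInvolution σ) :
    ∃ M : Finset (Fin (2 * ((n + 1) / 2)) × Fin (2 * ((n + 1) / 2))),
      IsNonNestingMatching M ∧ matchingForm n Ω M = involutionForm Ω σ :=
  ⟨_, hσ.isNonNestingMatching, matchingForm_involutionMatching Ω (by omega) fun f hf => by
    have := hσ.parity.1 f hf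
    omega⟩

theorem bijOn_borelOrbit_matchingForm {Ω : Type*} [Field Ω] [CharP Ω 2]
    (hΩ : IsQuadraticallyClosed Ω) (n : ℕ) : Set.BijOn
      (fun M : Finset (Fin (2 * ((n + 1) / 2)) × Fin (2 * ((n + 1) / 2))) =>
        borelOrbit (matchingForm n Ω M))
      {M | IsNonNestingMatching M} {O : BorelOrbit n Ω | bRank O = n} := by
  refine ⟨fun M hM => ?_, fun M hM M' hM' heq => ?_, fun O hO => ?_⟩
  · obtain ⟨σ, hσ, -, h⟩ := IsNonNestingMatching.exists_hasShape Ω hM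
    simp only [Set.mem_ofPred_eq, h]
    exact hσ.bRank_eq (hasShape_involutionForm hσ.involutive)
  · obtain ⟨σ, hσ, rfl, h⟩ := IsNonNestingMatching.exists_hasShape Ω hM
    obtain ⟨τ, hτ, rfl, h'⟩ := IsNonNestingMatching.exists_hasShape Ω hM'
    obtain ⟨b, hb, hbq⟩ := Quotient.exact heq
    rw [h, h'] at hbq
    have hshape := hasShape_involutionForm (Ω := Ω) hτ.involutive
    rw [← hbq] at hshape
    rw [(hasShape_involutionForm hσ.involutive).unique hb hshape]
  · induction O using Quotient.inductionOn with | h q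
    obtain ⟨b, hb, σ, hσ, hshape⟩ :=
      exists_isNonNestingInvolution hΩ (toralImage_finite_of_bRank_eq hO)
    obtain ⟨M, hM, h⟩ := hσ.exists_matchingForm_eq Ω
    refine ⟨M, hM, Quotient.sound ?_⟩
    rw [h, ← hshape.eq (hasShape_involutionForm hσ.involutive)]
    exact (borelSetoid n Ω).symm ⟨b, hb, rfl⟩

theorem isNormalForm_and_bRank_eq_iff {Ω : Type*} [Field Ω] [CharP Ω 2]
    (hΩ : IsQuadraticallyClosed Ω) {n : ℕ} (q : QForm n Ω) :
    IsNormalForm q ∧ bRank (borelOrbit q) = n ↔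
      ∃ M : Finset (Fin (2 * ((n + 1) / 2)) × Fin (2 * ((n + 1) / 2))),
        IsNonNestingMatching M ∧ matchingForm n Ω M = q := by
  constructor
  · rintro ⟨⟨D, rfl⟩, h⟩
    obtain ⟨σ, hσ, hform, -⟩ := D.exists_isNonNestingInvolution hΩ h
    rw [hform]
    exact hσ.exists_matchingForm_eq Ω
  · rintro ⟨M, hM, rfl⟩
    refine ⟨?_, (bijOn_borelOrbit_matchingForm hΩ n).mapsTo hM⟩
    obtain ⟨σ, hσ, -, h⟩ := hM.exists_hasShape Ω
    exact ⟨hσ.normalData, (hσ.form_normalData Ω).trans h.symm⟩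

theorem mainTheorem2 (Ω : Type*) [Field Ω] [CharP Ω 2] (hΩ : IsQuadraticallyClosed Ω) (n : ℕ) :
    -- the shape of the normal forms of maximal `B`-rank
    (∀ D : NormalData n, bRank (borelOrbit (D.form Ω)) = n →
      D.r = n / 2 + (if Odd n then 1 else 0) ∧
      (∀ t : Fin D.r, (t : ℕ) < n / 2 →
        D.i t < D.j t ∧ D.component Ω t = mon (D.i t) (D.i t) + mon (D.i t) (D.j t)) ∧
      (∀ t : Fin D.r, (t : ℕ) = n / 2 → D.component Ω t = mon (D.i t) (D.i t))) ∧
    -- the number of Borel orbits of maximal `B`-rank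
    {O : BorelOrbit n Ω | bRank O = n}.ncard = catalan ((n + 1) / 2) ∧
    -- the normal forms of maximal `B`-rank are those given by non-nesting perfect matchings
    (∀ q : QForm n Ω, IsNormalForm q ∧ bRank (borelOrbit q) = n ↔
      ∃ M : Finset (Fin (2 * ((n + 1) / 2)) × Fin (2 * ((n + 1) / 2))),
        IsNonNestingMatching M ∧ matchingForm n Ω M = q) ∧
    -- and these matchings parametrize the Borel orbits of maximal `B`-rank
    Set.BijOn
      (fun M : Finset (Fin (2 * ((n + 1) / 2)) × Fin (2 * ((n + 1) / 2))) =>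
        borelOrbit (matchingForm n Ω M))
      {M | IsNonNestingMatching M} {O : BorelOrbit n Ω | bRank O = n} := by
  refine ⟨fun D h => D.shape_of_bRank_eq hΩ h, ?_, isNormalForm_and_bRank_eq_iff hΩ,
    bijOn_borelOrbit_matchingForm hΩ n⟩
  have hbij := bijOn_borelOrbit_matchingForm hΩ n
  rw [← hbij.image_eq, hbij.injOn.ncard_image, ncard_isNonNestingMatching]
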